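/- **Lemma (Accuracy of the low-dimensional model).** *Network.* $N$ agents are connected by an undirected graph; $\mathcal N_k$ is the neighborhood of agent $k$ ($k\in\mathcal N_k$). Agent $k$ has a cost $J_k:\mathbb R^M\to\mathbb R$ with minimizer $w_k^o$. The agents are partitioned into clusters according to their minimizers (two agents are in the same cluster iff $w_k^o=w_\ell^o$), and into groups $\mathcal G_1,\dots,\mathcal G_G$, each contained in one cluster; every cluster and every group is connected. Let $A=[a_{\ell k}]$ satisfy $a_{\ell k}>0$ if $k,\ell$ are in the same group and $\ell\in\mathcal N_k$, $a_{\ell k}=0$ otherwise, and $\sum_\ell a_{\ell k}=1$. Let $A_m$ be the diagonal block of $A$ for $\mathcal G_m$, $N_m=|\mathcal G_m|$, and $p_m=\mathrm{col}\{p_k;k\in\mathcal G_m\}$ its Perron vector: $A_mp_m=p_m$, $\mathbf 1^{\mathsf T}p_m=1$. *Costs.* Each $J_k$ is strictly convex and twice differentiable with $\lambda_{k,L}I\le\nabla^2J_k(w)\le\lambda_{k,U}I$ for all $w$, $0\le\lambda_{k,L}\le\lambda_{k,U}<\infty$; every group contains an agent with $\lambda_{k,L}>0$; and $\nabla^2J(\mathcal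 W)=\mathrm{diag}\{\nabla^2J_k(w_k)\}$ is Lipschitz in $\mathcal W=\mathrm{col}\{w_k\}\in\mathbb R^{NM}$ for the matrix 2-norm. *Noise.* On a filtered probability space, $\widehat{\nabla J_k}$ (at time $i$) is a random approximation of the map $\nabla J_k$; let $\boldsymbol{\mathcal S}_i(\mathcal W)=\mathrm{col}\{\widehat{\nabla J_k}(w_k)-\nabla J_k(w_k)\}$ and $\mathcal W^o=\mathrm{col}\{w_k^o\}$. For every $\mathbb F_{i-1}$-measurable random vector $\boldsymbol{\mathcal W}$, $\boldsymbol{\mathcal S}_i(\boldsymbol{\mathcal W})$ is $\mathbb F_i$-measurable. For every such $\boldsymbol{\mathcal W}$ that has a finite fourth moment, with $\mathcal R_{s,i}(\boldsymbol{\mathcal W})=\mathbb E[\boldsymbol{\mathcal S}_i(\boldsymbol{\mathcal W})\boldsymbol{\mathcal S}_i(\boldsymbol{\mathcal W})^{\mathsf T}|\mathbb F_{i-1}]$, almost surely: $\mathbb E[\boldsymbol{\mathcal S}_i(\boldsymbol{\mathcal W})|\mathbb F_{i-1}]=0$; $\mathbb E[\|\boldsymbol{\mathcal S}_i(\boldsymbol{\mathcal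 W})\|^4|\mathbb F_{i-1}]\le\alpha^2\|\mathcal W^o-\boldsymbol{\mathcal W}\|^4+\sigma_s^4$ (so $\boldsymbol{\mathcal S}_i(\boldsymbol{\mathcal W})$ has a finite fourth moment); $\|\mathcal R_{s,i}(\mathcal W^o)-\mathcal R_{s,i}(\boldsymbol{\mathcal W})\|\le\kappa_s\|\mathcal W^o-\boldsymbol{\mathcal W}\|^{\gamma_s}$. Here $\alpha,\sigma_s,\kappa_s\ge0$ and $0<\gamma_s\le4$ do not depend on $i$ and $\boldsymbol{\mathcal W}$. Moreover $\mathcal R_{s,i}(\mathcal W^o)\to\mathcal R_s$ almost surely as $i\to\infty$, for some deterministic positive definite $\mathcal R_s$. *Recursions.* For step-sizes $\mu_k>0$ put $\mu_{\max}=\max_k\mu_k$, $\mathcal A=A\otimes I_M$, $\mathcal M=\mathrm{diag}\{\mu_k\}\otimes I_M$, $H_k=\nabla^2J_k(w_k^o)$, $\mathcal H=\mathrm{diag}\{H_k\}$, $\mathcal B=\mathcal A^{\mathsf T}(I-\mathcal M\mathcal H)$, $\bar H_m=\sum_{k\in\mathcal G_m}\frac{p_k\mu_k}{\mu_{\max}}H_k$,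 $\mathcal D=\mathrm{diag}\{I_M-\mu_{\max}\bar H_m\}_{m=1}^G$, $\mathcal P=\mathrm{diag}\{p_1,\dots,p_G\}\otimes I_M$ (agents ordered by groups). For $i\ge0$ let $\boldsymbol{\mathcal W}_i=\mathrm{col}\{\boldsymbol w_{k,i}\}$ be generated by $$\boldsymbol\psi_{k,i}=\boldsymbol w_{k,i-1}-\mu_k\widehat{\nabla J_k}(\boldsymbol w_{k,i-1}),\qquad \boldsymbol w_{k,i}=\sum_{\ell}a_{\ell k}\boldsymbol\psi_{\ell,i},$$ and let the long-term and the low-dimensional (centroid) models be $$\widetilde{\boldsymbol{\mathcal W}}{}_i^{\rm long}=\mathcal B\,\widetilde{\boldsymbol{\mathcal W}}{}_{i-1}^{\rm long}+\mathcal A^{\mathsf T}\mathcal M\boldsymbol{\mathcal S}_i(\boldsymbol{\mathcal W}_{i-1})\in\mathbb R^{NM},\qquad \widetilde{\boldsymbol{\mathcal W}}{}_i^{\rm low}=\mathcal D\,\widetilde{\boldsymbol{\mathcal W}}{}_{i-1}^{\rm low}+\mathcal P^{\mathsf T}\mathcal M\boldsymbol{\mathcal S}_i(\boldsymbol{\mathcal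 W}_{i-1})\in\mathbb R^{GM},$$ where $\boldsymbol{\mathcal W}_{-1}$ is $\mathbb F_{-1}$-measurable with a finite fourth moment, and the initial states of the two models are random vectors with finite second moments. Write $\widetilde{\boldsymbol{\mathcal W}}{}_i^{\rm low}=\mathrm{col}\{\widetilde{\boldsymbol w}{}_{1,i}^{\rm low},\dots,\widetilde{\boldsymbol w}{}_{G,i}^{\rm low}\}$ and $\bar{\boldsymbol{\mathcal W}}{}_i^{\rm low}=\mathrm{col}\{\mathbf 1_{N_m}\otimes\widetilde{\boldsymbol w}{}_{m,i}^{\rm low};\ m=1,\dots,G\}\in\mathbb R^{NM}$. *Claim.* For sufficiently small step-sizes of comparable size, $$\limsup_{i\to\infty}\mathbb E\big\|\widetilde{\boldsymbol{\mathcal W}}{}_i^{\rm long}-\bar{\boldsymbol{\mathcal W}}{}_i^{\rm low}\big\|^2=O(\mu_{\max}^2).$$ That is: for every $\tau>0$ there are $\mu_0>0$ and $C\ge0$ such that for all step-sizes $\mu_k>0$ with $\mu_{\max}\le\mu_0$ and $\mu_k\ge\tau\mu_{\max}$ for all $k$, and all initial states as above, the limit superior is at most $C\mu_{\max}^2$.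 -/

import Mathlib

open MeasureTheory ProbabilityTheory Filter Topology

noncomputable section

namespace ClusterNet

/-- Parameter vectors `w ∈ ℝ^M` with the Euclidean norm. -/
abbrev Param (M : ℕ) := EuclideanSpace ℝ (Fin M)

/-- Stacked vectors `col{x_1, …, x_n}` of `n` blocks `x_k ∈ ℝ^M`, with the Euclidean norm of
`ℝ^{nM}` (`‖x‖² = ∑_k ‖x_k‖²`). Used with `n = N` (agents) and `n = G` (groups). -/
abbrev Stack (n M : ℕ) := PiLp 2 (fun _ : Fin n => Param M)

/-- The stacked vector with the given blocks. -/
def col {n M : ℕ} (x : Fin n → Param M) : Stack n M := WithLp.toLp 2 x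

/-! ### Topology, clusters, groups, combination weights -/

/-- The network is an undirected graph `Gr` on the agents. Agents are partitioned into clusters
according to their minimizers `wo k`, and every cluster is connected. Groups are connected sets of
agents that partition the network, every group lying inside one cluster. -/
structure TopologyAssumption {N Q G M : ℕ} (Gr : SimpleGraph (Fin N)) (wo : Fin N → Param M)
    (cluster : Fin N → Fin Q) (group : Fin N → Fin G) : Prop where
  cluster_iff : ∀ k l, cluster k = cluster l ↔ wo k = wo l
  cluster_connected : ∀ q, (Gr.induce {k | cluster k = q}).Connected
  group_connected : ∀ m, (Gr.induce {k | group k = m}).Connected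
  group_le_cluster : ∀ k l, group k = group l → cluster k = cluster l

/-- `A l k` is the weight `a_{lk}` that agent `k` gives to agent `l`: positive exactly when `l` is
in the group of `k` and in the neighborhood of `k` (which contains `k` itself), with unit column
sums. -/
structure IsCombinationMatrix {N G : ℕ} (Gr : SimpleGraph (Fin N)) (group : Fin N → Fin G)
    (A : Matrix (Fin N) (Fin N) ℝ) : Prop where
  pos : ∀ l k, group l = group k → (l = k ∨ Gr.Adj l k) → 0 < A l k
  zero : ∀ l k, ¬ (group l = group k ∧ (l = k ∨ Gr.Adj l k)) → A l k = 0
  col_sum : ∀ k, ∑ l, A l k = 1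

/-- `p` is the stacked Perron vector: within every group it is the right eigenvector of that
group's (diagonal) block of `A` at the eigenvalue one, with entries adding up to one. -/
structure IsPerronVector {N G : ℕ} (group : Fin N → Fin G) (A : Matrix (Fin N) (Fin N) ℝ)
    (p : Fin N → ℝ) : Prop where
  eigen : ∀ k, ∑ l with group l = group k, A k l * p l = p k
  sum_one : ∀ m, ∑ k with group k = m, p k = 1

/-! ### Costs -/

/-- The Hessian `∇²J(w)` as an operator on `ℝ^M`. -/
def hess {M : ℕ} (J : Param M → ℝ) (w : Param M) : Param M →L[ℝ] Param M :=
  fderiv ℝ (gradient J) w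

/-- The block-diagonal operator `diag{T_1, …, T_n}`. -/
def blockDiag {n M : ℕ} (T : Fin n → (Param M →L[ℝ] Param M)) : Stack n M →L[ℝ] Stack n M :=
  { toFun := fun x => col fun k => T k (x k)
    map_add' := fun x y => by ext k : 1; simp only [col, PiLp.add_apply, map_add]
    map_smul' := fun c x => by ext k : 1; simp only [col, PiLp.smul_apply, map_smul, RingHom.id_apply]
    cont := (PiLp.continuous_toLp 2 _).comp (continuous_pi fun k =>
      (T k).continuous.comp (PiLp.continuous_apply 2 _ k)) }

/-- The network Hessian `diag{∇²J_1(w_1), …, ∇²J_N(w_N)}`. -/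
def netHess {N M : ℕ} (J : Fin N → Param M → ℝ) (W : Stack N M) : Stack N M →L[ℝ] Stack N M :=
  blockDiag fun k => hess (J k) (W k)

/-- Assumptions on the individual costs `J k`, with minimizers `wo k`. -/
structure CostAssumption {N G M : ℕ} (J : Fin N → Param M → ℝ) (wo : Fin N → Param M)
    (group : Fin N → Fin G) : Prop where
  minimizer : ∀ k w, J k (wo k) ≤ J k w
  strictConvex : ∀ k, StrictConvexOn ℝ Set.univ (J k)
  differentiable : ∀ k, Differentiable ℝ (J k)
  twice_differentiable : ∀ k, Differentiable ℝ (gradient (J k))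
  /-- `λ_{k,L} I ≤ ∇²J_k ≤ λ_{k,U} I`, with a positive `λ_{k,L}` somewhere in each group. -/
  hess_bounds : ∃ lamL lamU : Fin N → ℝ,
    (∀ k, 0 ≤ lamL k ∧ lamL k ≤ lamU k) ∧
    (∀ k w v, lamL k * ‖v‖ ^ 2 ≤ inner ℝ (hess (J k) w v) v ∧
      inner ℝ (hess (J k) w v) v ≤ lamU k * ‖v‖ ^ 2) ∧
    (∀ m, ∃ k, group k = m ∧ 0 < lamL k)
  hess_lipschitz : ∃ kH : ℝ, 0 ≤ kH ∧
    ∀ W₁ W₂ : Stack N M, ‖netHess J W₁ - netHess J W₂‖ ≤ kH * ‖W₁ - W₂‖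

/-! ### Gradient noise

Time is shifted by one: index `n` of the filtration and of the iterates stands for the time
`n - 1`, so that `n = 0` is the initial time `-1`; `ghat n` is the stochastic gradient used in the
step from index `n` to index `n + 1`. -/

section Noise

variable {Ω : Type*} {N M : ℕ}

/-- The network gradient noise `𝒮(W) = col{ĝ_k(w_k) - ∇J_k(w_k)}`. -/
def noise (J : Fin N → Param M → ℝ) (ghat : ℕ → Ω → Fin N → Param M → Param M)
    (n : ℕ) (ω : Ω) (W : Stack N M) : Stack N M :=
  col fun k => ghat n ω k (W k) - gradient (J k) (W k)

/-- The conditional covariance `𝓡(W) = E[𝒮(W) 𝒮(W)ᵀ | 𝔽]`, an `NM × NM` random matrix. -/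
def condCov {mΩ : MeasurableSpace Ω} (P : Measure Ω) (F : Filtration ℕ mΩ)
    (J : Fin N → Param M → ℝ) (ghat : ℕ → Ω → Fin N → Param M → Param M)
    (n : ℕ) (W : Ω → Stack N M) (ω : Ω) : Matrix (Fin N × Fin M) (Fin N × Fin M) ℝ :=
  Matrix.of fun a b =>
    (P[fun ω' => noise J ghat n ω' (W ω') a.1 a.2 * noise J ghat n ω' (W ω') b.1 b.2 | F n]) ω

/-- Assumptions on the gradient noise, for every random vector `W` that is measurable with respect
to the past and has a finite fourth moment. -/
structure NoiseAssumption {mΩ : MeasurableSpace Ω} (P : Measure Ω) (F : Filtration ℕ mΩ)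
    (J : Fin N → Param M → ℝ) (wo : Fin N → Param M)
    (ghat : ℕ → Ω → Fin N → Param M → Param M) : Prop where
  adapted : ∀ (n : ℕ) (W : Ω → Stack N M), StronglyMeasurable[F n] W →
    StronglyMeasurable[F (n + 1)] fun ω => noise J ghat n ω (W ω)
  martingale_diff : ∀ (n : ℕ) (W : Ω → Stack N M), StronglyMeasurable[F n] W → MemLp W 4 P →
    P[fun ω => noise J ghat n ω (W ω) | F n] =ᵐ[P] 0
  fourth_moment : ∃ α σ : ℝ, 0 ≤ α ∧ 0 ≤ σ ∧
    ∀ (n : ℕ) (W : Ω → Stack N M), StronglyMeasurable[F n] W → MemLp W 4 P →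
      MemLp (fun ω => noise J ghat n ω (W ω)) 4 P ∧
      P[fun ω => ‖noise J ghat n ω (W ω)‖ ^ 4 | F n]
        ≤ᵐ[P] fun ω => α ^ 2 * ‖col wo - W ω‖ ^ 4 + σ ^ 4
  cov_lipschitz : ∃ κ γ : ℝ, 0 ≤ κ ∧ 0 < γ ∧ γ ≤ 4 ∧
    ∀ (n : ℕ) (W : Ω → Stack N M), StronglyMeasurable[F n] W → MemLp W 4 P →
      ∀ᵐ ω ∂P, ‖Matrix.toEuclideanCLM (𝕜 := ℝ)
          (condCov P F J ghat n (fun _ => col wo) ω - condCov P F J ghat n W ω)‖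
        ≤ κ * ‖col wo - W ω‖ ^ γ
  cov_converges : ∃ R : Matrix (Fin N × Fin M) (Fin N × Fin M) ℝ, R.PosDef ∧
    ∀ᵐ ω ∂P, Tendsto (fun n => condCov P F J ghat n (fun _ => col wo) ω) atTop (𝓝 R)

end Noise

/-! ### The three recursions -/

/-- `μ_max`. -/
def stepMax {N : ℕ} (μ : Fin N → ℝ) : ℝ := ⨆ k, μ k

/-- `𝓐ᵀ = Aᵀ ⊗ I_M`. -/
def bigAT {N M : ℕ} (A : Matrix (Fin N) (Fin N) ℝ) : Stack N M →L[ℝ] Stack N M :=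
  { toFun := fun x => col fun k => ∑ l, A l k • x l
    map_add' := fun x y => by
      ext k : 1; simp only [col, PiLp.add_apply, smul_add, Finset.sum_add_distrib]
    map_smul' := fun c x => by
      ext k : 1; simp only [col, PiLp.smul_apply, Finset.smul_sum, smul_comm c, RingHom.id_apply]
    cont := (PiLp.continuous_toLp 2 _).comp (continuous_pi fun k =>
      continuous_finsetSum _ fun l _ => (PiLp.continuous_apply 2 _ l).const_smul (A l k)) }

/-- `𝓜 = diag{μ_1, …, μ_N} ⊗ I_M`. -/
def bigM {N M : ℕ} (μ : Fin N → ℝ) : Stack N M →L[ℝ] Stack N M :=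
  blockDiag fun k => μ k • ContinuousLinearMap.id ℝ (Param M)

/-- `𝓑 = 𝓐ᵀ (I - 𝓜 𝓗)` with `𝓗 = diag{∇²J_k(w_k^o)}`. -/
def bigB {N M : ℕ} (A : Matrix (Fin N) (Fin N) ℝ) (J : Fin N → Param M → ℝ)
    (wo : Fin N → Param M) (μ : Fin N → ℝ) : Stack N M →L[ℝ] Stack N M :=
  (bigAT A).comp (ContinuousLinearMap.id ℝ (Stack N M) - (bigM μ).comp (netHess J (col wo)))

/-- `H̄_m = ∑_{k ∈ 𝒢_m} (p_k μ_k / μ_max) ∇²J_k(w_k^o)`. -/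
def barH {N G M : ℕ} (J : Fin N → Param M → ℝ) (wo : Fin N → Param M) (group : Fin N → Fin G)
    (p μ : Fin N → ℝ) (m : Fin G) : Param M →L[ℝ] Param M :=
  ∑ k with group k = m, (p k * μ k / stepMax μ) • hess (J k) (wo k)

/-- `𝓓 = diag{D_1, …, D_G}` with `D_m = I - μ_max H̄_m`. -/
def bigD {N G M : ℕ} (J : Fin N → Param M → ℝ) (wo : Fin N → Param M) (group : Fin N → Fin G)
    (p μ : Fin N → ℝ) : Stack G M →L[ℝ] Stack G M :=
  blockDiag fun m => ContinuousLinearMap.id ℝ (Param M) - stepMax μ • barH J wo group p μ m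

/-- `𝓟ᵀ x`, where `𝓟 = diag{p_1, …, p_G} ⊗ I_M` has the Perron vectors of the groups as blocks. -/
def bigPT {N G M : ℕ} (group : Fin N → Fin G) (p : Fin N → ℝ) (x : Stack N M) : Stack G M :=
  col fun m => ∑ k with group k = m, p k • x k

/-- `col{1 ⊗ y_1, …, 1 ⊗ y_G}`: every agent gets the block of its group. -/
def lift {N G M : ℕ} (group : Fin N → Fin G) (y : Stack G M) : Stack N M :=
  col fun k => y (group k)

section Recursions

variable {Ω : Type*} {N G M : ℕ}

/-- The adapt-then-combine diffusion strategy
`ψ_k = w_k - μ_k ĝ_k(w_k)`, `w_k⁺ = ∑_l a_{lk} ψ_l`. -/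
def atc (ghat : ℕ → Ω → Fin N → Param M → Param M) (A : Matrix (Fin N) (Fin N) ℝ)
    (μ : Fin N → ℝ) (W₀ : Ω → Stack N M) : ℕ → Ω → Stack N M
  | 0, ω => W₀ ω
  | n + 1, ω => col fun k =>
      ∑ l, A l k • (atc ghat A μ W₀ n ω l - μ l • ghat n ω l (atc ghat A μ W₀ n ω l))

/-- The long-term model `X⁺ = 𝓑 X + 𝓐ᵀ 𝓜 𝒮(W)`, driven by the noise along the iterates `W`. -/
def longModel (J : Fin N → Param M → ℝ) (wo : Fin N → Param M)
    (ghat : ℕ → Ω → Fin N → Param M → Param M) (A : Matrix (Fin N) (Fin N) ℝ)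
    (μ : Fin N → ℝ) (W : ℕ → Ω → Stack N M) (X₀ : Ω → Stack N M) : ℕ → Ω → Stack N M
  | 0, ω => X₀ ω
  | n + 1, ω => bigB A J wo μ (longModel J wo ghat A μ W X₀ n ω)
      + bigAT A (bigM μ (noise J ghat n ω (W n ω)))

/-- The low-dimensional (centroid) model `Y⁺ = 𝓓 Y + 𝓟ᵀ 𝓜 𝒮(W)`. -/
def lowModel (J : Fin N → Param M → ℝ) (wo : Fin N → Param M)
    (ghat : ℕ → Ω → Fin N → Param M → Param M) (group : Fin N → Fin G) (p : Fin N → ℝ)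
    (μ : Fin N → ℝ) (W : ℕ → Ω → Stack N M) (Y₀ : Ω → Stack G M) : ℕ → Ω → Stack G M
  | 0, ω => Y₀ ω
  | n + 1, ω => bigD J wo group p μ (lowModel J wo ghat group p μ W Y₀ n ω)
      + bigPT group p (bigM μ (noise J ghat n ω (W n ω)))

end Recursions

end ClusterNet

end

namespace ClusterNet

/-! ### The weighted quadratic form -/

section Weighted

variable {N M : ℕ}

/-! Let `Q` replace every block by the `p`-weighted mean over its group. Since `Q` absorbs `𝓐ᵀ` on
either side, the lifted centroid model `Y` obeys `Y⁺ = Q𝓑Y + Q𝓜𝒮` (`lift_bigD`), while the long-term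
model obeys `X⁺ = 𝓑X + 𝓐ᵀ𝓜𝒮` with the same noise. As `QY = Y`, the difference splits as `X - Y = Q(X
- Y) + (X - QX)`, and each part is shown to have second moment `O(μ²)`, where `μ` stands for
`μ_max`.

The deviation `X - QX` is contracted by `𝓐ᵀ` at a rate `1 - δ` that does not depend on the
step-sizes (`exists_mixing`, `wsq_deviation_step`). Its forcing `-𝓜𝓗X + 𝓜𝒮` has second moment of
order `μ²`, as `X` and `𝒮` have bounded second moments.

In the mean part `Q(X - Y)` the noise cancels. What remains is a contraction at rate `1 - cμ`,
forced only by `Q𝓜𝓗(X - QX)` (`wsq_mean_step`). In squares, and after Young's inequality with weight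
of order `μ`, the forcing is of order `μ⁻¹ · μ² · μ² = μ³`; dividing by the gap `cμ` gives `μ²`.

Everything is measured in `∑ p_k ‖x_k‖²`, which `𝓐ᵀ` does not increase: it drops by exactly the
`spread`. Spread and the monotonicity of the gradients together form a positive definite quadratic
form, whence the contraction (`exists_contraction`). It applies to the linear map `𝓑` and to the
nonlinear error of the iterates; the latter bounds the noise (`eventually_noise_le`). Initial states
only affect the time from which the bounds hold. -/

lemma norm_sq_eq_sum (x : Stack N M) : ‖x‖ ^ 2 = ∑ k, ‖x k‖ ^ 2 :=
  PiLp.norm_sq_eq_of_L2 _ x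

lemma bigAT_apply (A : Matrix (Fin N) (Fin N) ℝ) (x : Stack N M) (k : Fin N) :
    bigAT A x k = ∑ l, A l k • x l := rfl

lemma bigM_apply (μ : Fin N → ℝ) (x : Stack N M) (k : Fin N) : bigM μ x k = μ k • x k := rfl

/-- The weighted inner product `∑_k p_k ⟨x_k, y_k⟩`. -/
noncomputable def wbil (p : Fin N → ℝ) (x y : Stack N M) : ℝ := inner ℝ (bigM p x) y

/-- The weighted squared norm `∑_k p_k ‖x_k‖²`. -/
noncomputable def wsq (p : Fin N → ℝ) (x : Stack N M) : ℝ := ∑ k, p k * ‖x k‖ ^ 2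

lemma wbil_eq_sum (p : Fin N → ℝ) (x y : Stack N M) :
    wbil p x y = ∑ k, p k * inner ℝ (x k) (y k) := by
  rw [wbil, PiLp.inner_apply]
  exact Finset.sum_congr rfl fun k _ => by rw [bigM_apply, real_inner_smul_left]

lemma wsq_add (p : Fin N → ℝ) (x y : Stack N M) :
    wsq p (x + y) = wsq p x + 2 * wbil p x y + wsq p y := by
  simp only [wsq, wbil_eq_sum, Finset.mul_sum, ← Finset.sum_add_distrib, PiLp.add_apply]
  refine Finset.sum_congr rfl fun k _ => ?_
  rw [norm_add_sq_real]; ring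

lemma wsq_neg (p : Fin N → ℝ) (x : Stack N M) : wsq p (-x) = wsq p x := by
  simp [wsq]

lemma wsq_sub (p : Fin N → ℝ) (x y : Stack N M) :
    wsq p (x - y) = wsq p x - 2 * wbil p x y + wsq p y := by
  rw [sub_eq_add_neg, wsq_add, wsq_neg]
  simp only [wbil, inner_neg_right]; ring

variable {p : Fin N → ℝ}

lemma wsq_nonneg (hp : ∀ k, 0 ≤ p k) (x : Stack N M) : 0 ≤ wsq p x :=
  Finset.sum_nonneg fun k _ => mul_nonneg (hp k) (sq_nonneg _)

lemma wsq_le_norm_sq (hp : ∀ k, p k ≤ 1) (x : Stack N M) : wsq p x ≤ ‖x‖ ^ 2 := by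
  rw [norm_sq_eq_sum]
  exact Finset.sum_le_sum fun k _ => mul_le_of_le_one_left (sq_nonneg _) (hp k)

lemma mul_norm_sq_le_wsq {c : ℝ} (hp : ∀ k, c ≤ p k) (x : Stack N M) : c * ‖x‖ ^ 2 ≤ wsq p x := by
  rw [norm_sq_eq_sum, Finset.mul_sum]
  exact Finset.sum_le_sum fun k _ => mul_le_mul_of_nonneg_right (hp k) (sq_nonneg _)

/-- Young's inequality with a free weight: a small `η` preserves a contraction of `x`, at the price
`η⁻¹` on the forcing `y`. -/
lemma norm_add_sq_le_of_pos {E : Type*} [NormedAddCommGroup E] [InnerProductSpace ℝ E]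
    {η : ℝ} (hη : 0 < η) (x y : E) :
    ‖x + y‖ ^ 2 ≤ (1 + η) * ‖x‖ ^ 2 + (1 + η⁻¹) * ‖y‖ ^ 2 := by
  have h1 : ‖x + y‖ ^ 2 ≤ (‖x‖ + ‖y‖) ^ 2 := by gcongr; exact norm_add_le x y
  have h2 : 2 * ‖x‖ * ‖y‖ ≤ η * ‖x‖ ^ 2 + η⁻¹ * ‖y‖ ^ 2 := by
    have h3 : 0 ≤ η⁻¹ * (η * ‖x‖ - ‖y‖) ^ 2 := by positivity
    have h4 : η⁻¹ * (η * ‖x‖ - ‖y‖) ^ 2 = η * ‖x‖ ^ 2 - 2 * ‖x‖ * ‖y‖ + η⁻¹ * ‖y‖ ^ 2 := by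
      field_simp
      ring
    linarith
  nlinarith

lemma wsq_add_le (hp : ∀ k, 0 ≤ p k) {η : ℝ} (hη : 0 < η) (x y : Stack N M) :
    wsq p (x + y) ≤ (1 + η) * wsq p x + (1 + η⁻¹) * wsq p y := by
  simp only [wsq, Finset.mul_sum, ← Finset.sum_add_distrib, PiLp.add_apply]
  refine Finset.sum_le_sum fun k _ => ?_
  have := mul_le_mul_of_nonneg_left (norm_add_sq_le_of_pos hη (x k) (y k)) (hp k)
  linarith

lemma wsq_add_le_two (hp : ∀ k, 0 ≤ p k) (x y : Stack N M) :
    wsq p (x + y) ≤ 2 * wsq p x + 2 * wsq p y := by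
  have := wsq_add_le hp one_pos x y
  norm_num at this
  exact this

lemma wsq_sub_le_two (hp : ∀ k, 0 ≤ p k) (x y : Stack N M) :
    wsq p (x - y) ≤ 2 * wsq p x + 2 * wsq p y := by
  rw [sub_eq_add_neg, ← wsq_neg p y]
  exact wsq_add_le_two hp x (-y)

lemma wsq_le_of_norm_le (hp : ∀ k, 0 ≤ p k) {c : ℝ} (x y : Stack N M)
    (h : ∀ k, ‖x k‖ ≤ c * ‖y k‖) : wsq p x ≤ c ^ 2 * wsq p y := by
  rw [wsq, wsq, Finset.mul_sum]
  refine Finset.sum_le_sum fun k _ => ?_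
  have h1 : ‖x k‖ ^ 2 ≤ (c * ‖y k‖) ^ 2 := by gcongr; exact h k
  have := mul_le_mul_of_nonneg_left h1 (hp k)
  linarith [this]

lemma wsq_bigM_le (hp : ∀ k, 0 ≤ p k) {μ : Fin N → ℝ} {m : ℝ} (h0 : ∀ k, 0 ≤ μ k)
    (hm : ∀ k, μ k ≤ m) (x : Stack N M) : wsq p (bigM μ x) ≤ m ^ 2 * wsq p x := by
  refine wsq_le_of_norm_le hp _ _ fun k => ?_
  rw [bigM_apply, norm_smul, Real.norm_eq_abs, abs_of_nonneg (h0 k)]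
  gcongr; exact hm k

/-! ### Averaging operators that preserve the weights -/

/-- A matrix with nonnegative entries and unit column sums that fixes `p`. -/
structure IsAveraging (A : Matrix (Fin N) (Fin N) ℝ) (p : Fin N → ℝ) : Prop where
  nonneg : ∀ l k, 0 ≤ A l k
  col_sum : ∀ k, ∑ l, A l k = 1
  fix : ∀ l, ∑ k, A l k * p k = p l

/-- The spread `∑_k p_k ∑_l a_{lk} ‖x_l - (𝓐ᵀ x)_k‖²`. -/
noncomputable def spread (A : Matrix (Fin N) (Fin N) ℝ) (p : Fin N → ℝ) (x : Stack N M) : ℝ :=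
  ∑ k, p k * ∑ l, A l k * ‖x l - bigAT A x k‖ ^ 2

lemma continuous_spread (A : Matrix (Fin N) (Fin N) ℝ) (p : Fin N → ℝ) :
    Continuous (spread A p : Stack N M → ℝ) := by
  unfold spread; fun_prop

variable {A : Matrix (Fin N) (Fin N) ℝ}

lemma spread_nonneg (hA : IsAveraging A p) (hp : ∀ k, 0 ≤ p k) (x : Stack N M) :
    0 ≤ spread A p x :=
  Finset.sum_nonneg fun k _ => mul_nonneg (hp k) <|
    Finset.sum_nonneg fun l _ => mul_nonneg (hA.nonneg l k) (sq_nonneg _)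

/-- For each `k` this is the variance identity for the probability weights `a_{lk}`; summed against
`p`, the mean square becomes `wsq p x` because `A` fixes `p`. -/
lemma wsq_bigAT (hA : IsAveraging A p) (x : Stack N M) :
    wsq p (bigAT A x) = wsq p x - spread A p x := by
  have h1 : ∀ k, ∑ l, A l k * ‖x l - bigAT A x k‖ ^ 2
      = ∑ l, A l k * ‖x l‖ ^ 2 - ‖bigAT A x k‖ ^ 2 := by
    intro k
    have h2 : ∀ l, A l k * ‖x l - bigAT A x k‖ ^ 2 = A l k * ‖x l‖ ^ 2
        - 2 * inner ℝ (A l k • x l) (bigAT A x k) + A l k * ‖bigAT A x k‖ ^ 2 := by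
      intro l
      rw [norm_sub_sq_real, real_inner_smul_left]; ring
    simp only [h2, Finset.sum_add_distrib, Finset.sum_sub_distrib, ← Finset.mul_sum,
      ← Finset.sum_mul, hA.col_sum, ← sum_inner, ← bigAT_apply, real_inner_self_eq_norm_sq]
    ring
  have h3 : ∑ k, p k * ∑ l, A l k * ‖x l‖ ^ 2 = wsq p x := by
    simp only [Finset.mul_sum, wsq]
    rw [Finset.sum_comm]
    refine Finset.sum_congr rfl fun l _ => ?_
    rw [← hA.fix l, Finset.sum_mul]
    exact Finset.sum_congr rfl fun k _ => by ring
  simp only [spread, h1, mul_sub, Finset.sum_sub_distrib, h3]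
  simp [wsq]

lemma wsq_bigAT_le (hA : IsAveraging A p) (hp : ∀ k, 0 ≤ p k) (x : Stack N M) :
    wsq p (bigAT A x) ≤ wsq p x := by
  rw [wsq_bigAT hA]; linarith [spread_nonneg hA hp x]

lemma spread_le_wsq (hA : IsAveraging A p) (hp : ∀ k, 0 ≤ p k) (x : Stack N M) :
    spread A p x ≤ wsq p x := by
  have := wsq_bigAT hA x
  linarith [wsq_nonneg hp (bigAT A x)]

lemma spread_add_le (hA : IsAveraging A p) (hp : ∀ k, 0 ≤ p k) (x y : Stack N M) :
    spread A p (x + y) ≤ 2 * spread A p x + 2 * spread A p y := by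
  simp only [spread, Finset.mul_sum, ← Finset.sum_add_distrib]
  refine Finset.sum_le_sum fun k _ => Finset.sum_le_sum fun l _ => ?_
  have h := norm_add_sq_le_of_pos one_pos (x l - bigAT A x k) (y l - bigAT A y k)
  have e : (x + y) l - bigAT A (x + y) k = (x l - bigAT A x k) + (y l - bigAT A y k) := by
    rw [map_add, PiLp.add_apply, PiLp.add_apply]; abel
  rw [e]
  have := mul_le_mul_of_nonneg_left h (mul_nonneg (hp k) (hA.nonneg l k))
  norm_num at this
  linarith

lemma bigAT_bigAT (A B : Matrix (Fin N) (Fin N) ℝ) (x : Stack N M) :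
    bigAT A (bigAT B x) = bigAT (B * A) x := by
  ext k : 1
  simp only [bigAT_apply, Matrix.mul_apply, Finset.smul_sum, Finset.sum_smul, smul_smul]
  rw [Finset.sum_comm]
  exact Finset.sum_congr rfl fun j _ => Finset.sum_congr rfl fun l _ => by rw [mul_comm]

/-- A continuous function that is homogeneous of degree two and positive away from zero dominates
a multiple of the squared norm. -/
lemma exists_pos_mul_norm_sq_le {q : Stack N M → ℝ} (hq : Continuous q)
    (hhom : ∀ (c : ℝ) x, q (c • x) = c ^ 2 * q x) (hpos : ∀ x, x ≠ 0 → 0 < q x) :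
    ∃ c, 0 < c ∧ ∀ x, c * ‖x‖ ^ 2 ≤ q x := by
  have h0 : q 0 = 0 := by simpa using hhom 0 0
  -- The sphere is empty only if the space is trivial; otherwise the minimum over the compact sphere
  -- is the constant.
  rcases (Metric.sphere (0 : Stack N M) 1).eq_empty_or_nonempty with he | hne
  · refine ⟨1, one_pos, fun x => ?_⟩
    rcases eq_or_ne x 0 with rfl | hx
    · simp [h0]
    · have : ‖x‖⁻¹ • x ∈ Metric.sphere (0 : Stack N M) 1 := by
        simp [norm_smul, hx]
      simp [he] at this
  · obtain ⟨y, hy, hmin⟩ := (isCompact_sphere (0 : Stack N M) 1).exists_isMinOn hne hq.continuousOn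
    have hy0 : y ≠ 0 := by rintro rfl; simp at hy
    refine ⟨q y, hpos y hy0, fun x => ?_⟩
    rcases eq_or_ne x 0 with rfl | hx
    · simp [h0]
    · have hx' : 0 < ‖x‖ := norm_pos_iff.2 hx
      have : ‖x‖⁻¹ • x ∈ Metric.sphere (0 : Stack N M) 1 := by
        simp [norm_smul, hx]
      have h := hmin this
      simp only [Set.mem_ofPred_eq, hhom, inv_pow] at h
      rwa [inv_mul_eq_div, le_div_iff₀ (by positivity)] at h

end Weighted

/-! ### The combination matrix -/

section Combination

variable {N G M : ℕ} {Gr : SimpleGraph (Fin N)} {group : Fin N → Fin G}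
  {A : Matrix (Fin N) (Fin N) ℝ} {p : Fin N → ℝ}

lemma IsCombinationMatrix.nonneg (hA : IsCombinationMatrix Gr group A) (l k : Fin N) :
    0 ≤ A l k := by
  by_cases h : group l = group k ∧ (l = k ∨ Gr.Adj l k)
  · exact (hA.pos l k h.1 h.2).le
  · exact (hA.zero l k h).ge

lemma IsCombinationMatrix.eq_zero (hA : IsCombinationMatrix Gr group A) {l k : Fin N}
    (h : group l ≠ group k) : A l k = 0 := hA.zero l k fun h' => h h'.1

lemma IsPerronVector.fix (hA : IsCombinationMatrix Gr group A) (hp : IsPerronVector group A p)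
    (k : Fin N) : ∑ l, A k l * p l = p k := by
  rw [← hp.eigen k, Finset.sum_filter]
  refine Finset.sum_congr rfl fun l _ => ?_
  split_ifs with h
  · rfl
  · rw [hA.eq_zero (fun h' => h h'.symm), zero_mul]

/-- A property that passes to neighbours within a group holds on the whole group. -/
lemma forall_group_of_adj (hconn : ∀ m, (Gr.induce {k | group k = m}).Connected)
    {S : Fin N → Prop} (hS : ∀ k l, group k = group l → Gr.Adj k l → S k → S l)
    {k l : Fin N} (hkl : group k = group l) (hk : S k) : S l := by
  obtain ⟨w⟩ := (hconn (group l)).preconnected ⟨k, hkl⟩ ⟨l, rfl⟩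
  suffices ∀ (a b : {k | group k = group l}) (_ : (Gr.induce {k | group k = group l}).Walk a b),
      S a → S b from this _ _ w hk
  intro a b w
  induction w with
  | nil => exact id
  | @cons u v w h _ ih =>
    intro hu
    exact ih (hS _ _ (u.2.trans v.2.symm) h hu)

/-- A zero entry of a nonnegative fixed vector is a sum of nonnegative terms, so the entries of its
neighbours within the group vanish too; connectedness spreads this. -/
lemma eq_zero_on_group_of_fix (hA : IsCombinationMatrix Gr group A)
    (hconn : ∀ m, (Gr.induce {k | group k = m}).Connected) {q : Fin N → ℝ} (hq : ∀ k, 0 ≤ q k)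
    (hfix : ∀ k, ∑ l, A k l * q l = q k) {k l : Fin N} (hkl : group k = group l) (hk : q k = 0) :
    q l = 0 := by
  refine forall_group_of_adj (S := fun k => q k = 0) hconn (fun a b hab hadj ha => ?_) hkl hk
  have h := hfix a
  rw [ha, Finset.sum_eq_zero_iff_of_nonneg fun l _ => mul_nonneg (hA.nonneg a l) (hq l)] at h
  exact (mul_eq_zero.1 (h b (Finset.mem_univ b))).resolve_left (hA.pos a b hab (.inr hadj)).ne'

/-- Perron–Frobenius argument: `|p| ≤ A|p|` entrywise, and unit column sums make the totals equal,
so `|p|` is fixed as well. Then `|p| - p` is nonnegative and fixed, hence zero on a whole group or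
nowhere on it, and the unit sum excludes negative groups. Applied to `p` itself, the same dichotomy
excludes zeros. -/
lemma IsPerronVector.pos (hA : IsCombinationMatrix Gr group A) (hp : IsPerronVector group A p)
    (hconn : ∀ m, (Gr.induce {k | group k = m}).Connected) (k : Fin N) : 0 < p k := by
  have hfix := hp.fix hA
  have hle : ∀ k, |p k| ≤ ∑ l, A k l * |p l| := fun k => by
    conv_lhs => rw [← hfix k]
    refine (Finset.abs_sum_le_sum_abs _ _).trans (Finset.sum_le_sum fun l _ => ?_)
    rw [abs_mul, abs_of_nonneg (hA.nonneg k l)]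
  have hsum : ∑ k, ∑ l, A k l * |p l| = ∑ k, |p k| := by
    rw [Finset.sum_comm]
    exact Finset.sum_congr rfl fun l _ => by rw [← Finset.sum_mul, hA.col_sum, one_mul]
  have habs : ∀ k, ∑ l, A k l * |p l| = |p k| := fun k =>
    ((Finset.sum_eq_sum_iff_of_le fun k _ => hle k).1 hsum.symm k (Finset.mem_univ k)).symm
  have hnn : ∀ k, 0 ≤ p k := by
    intro k
    by_contra! hk
    have hneg : ∀ l, group l = group k → p l < 0 := by
      intro l hl
      by_contra! hl'
      have := eq_zero_on_group_of_fix hA hconn (q := fun k => |p k| - p k)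
        (fun k => sub_nonneg.2 (le_abs_self _))
        (fun k => by simp only [mul_sub, Finset.sum_sub_distrib, habs, hfix]) hl
        (by simp [abs_of_nonneg hl'])
      simp only [abs_of_neg hk] at this
      linarith
    have h1 := hp.sum_one (group k)
    have h2 : ∑ l with group l = group k, p l ≤ 0 :=
      Finset.sum_nonpos fun l hl => (hneg l (Finset.mem_filter.1 hl).2).le
    linarith
  refine (hnn k).lt_of_ne' fun hk => ?_
  have h1 := hp.sum_one (group k)
  rw [Finset.sum_eq_zero fun l hl => ?_] at h1
  · simp at h1
  · exact eq_zero_on_group_of_fix hA hconn hnn hfix (Finset.mem_filter.1 hl).2.symm hk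

lemma IsPerronVector.le_one (hp : IsPerronVector group A p) (hpos : ∀ k, 0 < p k) (k : Fin N) :
    p k ≤ 1 := by
  rw [← hp.sum_one (group k)]
  exact Finset.single_le_sum (f := p) (fun l _ => (hpos l).le) (by simp)

lemma IsCombinationMatrix.isAveraging (hA : IsCombinationMatrix Gr group A)
    (hp : IsPerronVector group A p) : IsAveraging A p :=
  ⟨hA.nonneg, hA.col_sum, hp.fix hA⟩

/-- The matrix whose transpose replaces every block by the weighted mean over its group. -/
noncomputable def meanMatrix (group : Fin N → Fin G) (p : Fin N → ℝ) :
    Matrix (Fin N) (Fin N) ℝ :=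
  Matrix.of fun l k => if group l = group k then p l else 0

lemma meanMatrix_isAveraging (hp : IsPerronVector group A p) (hpos : ∀ k, 0 < p k) :
    IsAveraging (meanMatrix group p) p where
  nonneg l k := by
    simp only [meanMatrix, Matrix.of_apply]; split_ifs
    exacts [(hpos l).le, le_rfl]
  col_sum k := by
    simp only [meanMatrix, Matrix.of_apply, ← Finset.sum_filter, hp.sum_one]
  fix l := by
    have := hp.sum_one (group l)
    simp only [meanMatrix, Matrix.of_apply, ite_mul, zero_mul, ← Finset.sum_filter,
      ← Finset.mul_sum]
    simp only [eq_comm (a := group l), this, mul_one]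

lemma meanMatrix_mul (hA : IsCombinationMatrix Gr group A) :
    meanMatrix group p * A = meanMatrix group p := by
  ext j k
  simp only [Matrix.mul_apply, meanMatrix, Matrix.of_apply]
  have : ∀ l, (if group j = group l then p j else 0) * A l k
      = (if group j = group k then p j else 0) * A l k := by
    intro l
    by_cases h : group l = group k
    · rw [h]
    · rw [hA.eq_zero h]; simp
  simp only [this, ← Finset.mul_sum, hA.col_sum, mul_one]

lemma mul_meanMatrix (hA : IsCombinationMatrix Gr group A) (hp : IsPerronVector group A p) :
    A * meanMatrix group p = meanMatrix group p := by
  ext j k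
  simp only [Matrix.mul_apply, meanMatrix, Matrix.of_apply]
  have : ∀ l, A j l * (if group l = group k then p l else 0)
      = (if group j = group k then 1 else 0) * (A j l * p l) := by
    intro l
    by_cases h : group j = group l
    · rw [h]; split_ifs <;> simp
    · rw [hA.eq_zero h]; simp
  simp only [this, ← Finset.mul_sum, hp.fix hA]
  simp

lemma meanMatrix_mul_self (hp : IsPerronVector group A p) :
    meanMatrix group p * meanMatrix group p = meanMatrix group p := by
  ext j k
  simp only [Matrix.mul_apply, meanMatrix, Matrix.of_apply]
  have : ∀ l, (if group j = group l then p j else 0) * (if group l = group k then p l else 0)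
      = (if group j = group k then p j else 0) * (if group l = group k then p l else 0) := by
    intro l
    by_cases h : group l = group k
    · rw [h]
    · simp [h]
  simp only [this, ← Finset.mul_sum, ← Finset.sum_filter, hp.sum_one, mul_one]

/-- This brings the centroid model into the space of the long-term model, with `Q` in place of `𝓟ᵀ`.
-/
lemma lift_bigPT (x : Stack N M) : lift group (bigPT group p x) = bigAT (meanMatrix group p) x := by
  ext k : 1
  simp only [lift, bigPT, col, bigAT_apply, meanMatrix, Matrix.of_apply, ite_smul, zero_smul,
    ← Finset.sum_filter]

lemma mean_lift (hp : IsPerronVector group A p) (y : Stack G M) :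
    bigAT (meanMatrix group p) (lift group y) = lift group y := by
  rw [← lift_bigPT]
  congr 1
  ext m : 1
  have : ∀ k ∈ Finset.univ.filter (fun k => group k = m), p k • lift group y k = p k • y m := by
    intro k hk
    simp [lift, col, (Finset.mem_filter.1 hk).2]
  change ∑ k with group k = m, p k • lift group y k = y m
  rw [Finset.sum_congr rfl this, ← Finset.sum_smul, hp.sum_one, one_smul]

/-- Zero spread makes `x_l` equal to `(𝓐ᵀx)_k` whenever `a_{lk} > 0`. As `a_{kk} > 0`, neighbours
within a group share the same block. -/
lemma eq_of_spread_eq_zero (hA : IsCombinationMatrix Gr group A)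
    (hconn : ∀ m, (Gr.induce {k | group k = m}).Connected) (hpos : ∀ k, 0 < p k)
    {x : Stack N M} (hx : spread A p x = 0) {k l : Fin N} (hkl : group k = group l) :
    x k = x l := by
  have h0 : ∀ k l, group l = group k → (l = k ∨ Gr.Adj l k) → x l = bigAT A x k := by
    intro k l h h'
    rw [spread, Finset.sum_eq_zero_iff_of_nonneg fun k _ => mul_nonneg (hpos k).le <|
      Finset.sum_nonneg fun l _ => mul_nonneg (hA.nonneg l k) (sq_nonneg _)] at hx
    have h1 := (mul_eq_zero.1 (hx k (Finset.mem_univ k))).resolve_left (hpos k).ne'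
    rw [Finset.sum_eq_zero_iff_of_nonneg fun l _ => mul_nonneg (hA.nonneg l k) (sq_nonneg _)] at h1
    have h2 := (mul_eq_zero.1 (h1 l (Finset.mem_univ l))).resolve_left (hA.pos l k h h').ne'
    simpa [sub_eq_zero] using h2
  refine forall_group_of_adj (S := fun l => x k = x l) hconn (fun a b hab hadj ha => ?_) hkl rfl
  exact ha.trans ((h0 b a hab (.inr hadj)).trans (h0 b b rfl (.inl rfl)).symm)

lemma spread_smul (c : ℝ) (x : Stack N M) : spread A p (c • x) = c ^ 2 * spread A p x := by
  simp only [spread, map_smul, PiLp.smul_apply, ← smul_sub, norm_smul, mul_pow, Finset.mul_sum,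
    Real.norm_eq_abs, sq_abs]
  exact Finset.sum_congr rfl fun k _ => Finset.sum_congr rfl fun l _ => by ring

/-- Combination contracts stacked vectors whose group means vanish. -/
lemma exists_mixing (hA : IsCombinationMatrix Gr group A) (hp : IsPerronVector group A p)
    (hconn : ∀ m, (Gr.induce {k | group k = m}).Connected) (M : ℕ) :
    ∃ δ : ℝ, 0 < δ ∧ δ ≤ 1 ∧ ∀ x : Stack N M, bigAT (meanMatrix group p) x = 0 →
      wsq p (bigAT A x) ≤ (1 - δ) * wsq p x := by
  have hpos := hp.pos hA hconn
  have hAv := hA.isAveraging hp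
  -- Definiteness: zero spread makes `x` constant on groups, hence equal to its group means, which
  -- the second term sends to zero.
  obtain ⟨c, hc, h⟩ := exists_pos_mul_norm_sq_le (N := N) (M := M)
    (q := fun x => spread A p x + ‖bigAT (meanMatrix group p) x‖ ^ 2)
    ((continuous_spread A p).add (by fun_prop))
    (fun c x => by simp only [spread_smul, map_smul, norm_smul, mul_pow, Real.norm_eq_abs, sq_abs]
                   ring)
    (fun x hx => by
      have h1 := spread_nonneg hAv (fun k => (hpos k).le) x
      have h2 : 0 ≤ ‖bigAT (meanMatrix group p) x‖ ^ 2 := sq_nonneg _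
      refine (add_nonneg h1 h2).lt_of_ne' fun h0 => hx ?_
      have h3 : spread A p x = 0 := by linarith
      have h4 : bigAT (meanMatrix group p) x = 0 := by
        have : ‖bigAT (meanMatrix group p) x‖ ^ 2 = 0 := by linarith
        simpa using this
      ext k : 1
      have h5 : bigAT (meanMatrix group p) x k = x k := by
        have h6 : ∀ l, meanMatrix group p l k • x l = meanMatrix group p l k • x k := by
          intro l
          by_cases h : group l = group k
          · rw [eq_of_spread_eq_zero hA hconn hpos h3 h]
          · simp [meanMatrix, h]
        rw [bigAT_apply, Finset.sum_congr rfl fun l _ => h6 l, ← Finset.sum_smul,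
          (meanMatrix_isAveraging hp hpos).col_sum, one_smul]
      rw [← h5, h4])
  refine ⟨min c 1, by positivity, min_le_right _ _, fun x hx => ?_⟩
  have h1 := h x
  simp only [hx, norm_zero, ne_eq, OfNat.ofNat_ne_zero, not_false_eq_true, zero_pow, add_zero] at h1
  have h2 := wsq_le_norm_sq (hp.le_one hpos) x
  have h3 := wsq_nonneg (fun k => (hpos k).le) x
  rw [wsq_bigAT hAv]
  have h4 : min c 1 * wsq p x ≤ c * ‖x‖ ^ 2 :=
    mul_le_mul (min_le_left _ _) h2 h3 hc.le
  linarith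

/-- Adaptation followed by combination contracts, for small comparable step-sizes, if every agent
has a monotone update direction and one agent of every group a strongly monotone one. -/
lemma exists_contraction (hA : IsCombinationMatrix Gr group A) (hp : IsPerronVector group A p)
    (hconn : ∀ m, (Gr.induce {k | group k = m}).Connected) (M : ℕ) {lam : Fin N → ℝ}
    (hlam : ∀ k, 0 ≤ lam k) (hlam' : ∀ m, ∃ k, group k = m ∧ 0 < lam k) (L : ℝ) {τ : ℝ}
    (hτ : 0 < τ) :
    ∃ c m₁ : ℝ, 0 < c ∧ 0 < m₁ ∧ ∀ (μ : Fin N → ℝ) (m : ℝ), 0 ≤ m → m ≤ m₁ →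
      (∀ k, 0 ≤ μ k) → (∀ k, μ k ≤ m) → (∀ k, τ * m ≤ μ k) → c * m ≤ 1 ∧
      ∀ x g : Stack N M, (∀ k, lam k * ‖x k‖ ^ 2 ≤ inner ℝ (x k) (g k)) →
        (∀ k, ‖g k‖ ≤ L * ‖x k‖) →
        wsq p (bigAT A (x - bigM μ g)) ≤ (1 - c * m) * wsq p x := by
  have hpos := hp.pos hA hconn
  have hnn := fun k => (hpos k).le
  have hAv := hA.isAveraging hp
  -- Definiteness: zero spread makes `x` constant on groups, and the agent with `lam l > 0` forces
  -- each constant to be zero.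
  obtain ⟨c, hc, h⟩ := exists_pos_mul_norm_sq_le (N := N) (M := M)
    (q := fun x => spread A p x + ∑ k, p k * (lam k * ‖x k‖ ^ 2))
    ((continuous_spread A p).add (by fun_prop))
    (fun c x => by
      simp only [spread_smul, PiLp.smul_apply, norm_smul, mul_pow, Real.norm_eq_abs, sq_abs,
        mul_add, Finset.mul_sum]
      congr 1
      exact Finset.sum_congr rfl fun k _ => by ring)
    (fun x hx => by
      have h1 := spread_nonneg hAv hnn x
      have ht : ∀ k ∈ Finset.univ, 0 ≤ p k * (lam k * ‖x k‖ ^ 2) := fun k _ =>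
        mul_nonneg (hnn k) (mul_nonneg (hlam k) (sq_nonneg _))
      have h2 := Finset.sum_nonneg ht
      refine (add_nonneg h1 h2).lt_of_ne' fun h0 => hx ?_
      have h3 : spread A p x = 0 := by linarith
      have h4 : ∑ k, p k * (lam k * ‖x k‖ ^ 2) = 0 := by linarith
      rw [Finset.sum_eq_zero_iff_of_nonneg ht] at h4
      ext k : 1
      obtain ⟨l, hl, hl'⟩ := hlam' (group k)
      rw [eq_of_spread_eq_zero hA hconn hpos h3 hl.symm]
      simpa [(hpos l).ne', hl'.ne'] using h4 l (Finset.mem_univ l))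
  -- The decrease available is half the spread of `x` (`hR`) plus twice the cross term, which is at
  -- least `τ m` times the monotone part (`hcross`); `κ m` times the definite form stays below it.
  set κ := min (1 / 2) (2 * τ) with hκ
  have hκ0 : 0 < κ := by positivity
  -- Of the rate `κ c`, half pays for the quadratic error `2 m² L²`, which the second bound on `m`
  -- allows; the third bound gives `c m ≤ 1` for the final rate.
  refine ⟨κ * c / 2, min 1 (min (κ * c / (4 * L ^ 2 + 1)) (2 / (κ * c))), by positivity,
    by positivity, fun μ m hm0 hm hμ0 hμm hμτ => ⟨?_, fun x g hg hgL => ?_⟩⟩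
  · have : m ≤ 2 / (κ * c) := hm.trans ((min_le_right _ _).trans (min_le_right _ _))
    rw [le_div_iff₀ (by positivity)] at this
    linarith
  have hm1 : m ≤ 1 := hm.trans (min_le_left _ _)
  have hm2 : m * (4 * L ^ 2 + 1) ≤ κ * c := by
    have : m ≤ κ * c / (4 * L ^ 2 + 1) := hm.trans ((min_le_right _ _).trans (min_le_left _ _))
    rwa [le_div_iff₀ (by positivity)] at this
  have hV := wsq_nonneg hnn x
  have hy : wsq p (bigM μ g) ≤ m ^ 2 * (L ^ 2 * wsq p x) :=
    (wsq_bigM_le hnn hμ0 hμm g).trans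
      (mul_le_mul_of_nonneg_left (wsq_le_of_norm_le hnn _ _ hgL) (sq_nonneg m))
  have hR : spread A p x ≤ 2 * spread A p (x - bigM μ g) + 2 * (m ^ 2 * (L ^ 2 * wsq p x)) := by
    have h1 := spread_add_le hAv hnn (x - bigM μ g) (bigM μ g)
    rw [sub_add_cancel] at h1
    linarith [spread_le_wsq hAv hnn (bigM μ g)]
  have hcross : τ * m * ∑ k, p k * (lam k * ‖x k‖ ^ 2) ≤ wbil p x (bigM μ g) := by
    rw [wbil_eq_sum, Finset.mul_sum]
    refine Finset.sum_le_sum fun k _ => ?_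
    rw [bigM_apply, real_inner_smul_right]
    have h1 : τ * m * (lam k * ‖x k‖ ^ 2) ≤ μ k * inner ℝ (x k) (g k) :=
      mul_le_mul (hμτ k) (hg k) (mul_nonneg (hlam k) (sq_nonneg _)) (hμ0 k)
    have := mul_le_mul_of_nonneg_left h1 (hnn k)
    linarith
  have hq : κ * m * (c * wsq p x) ≤
      1 / 2 * spread A p x + 2 * (τ * m * ∑ k, p k * (lam k * ‖x k‖ ^ 2)) := by
    have h1 : c * wsq p x ≤ spread A p x + ∑ k, p k * (lam k * ‖x k‖ ^ 2) :=
      (mul_le_mul_of_nonneg_left (wsq_le_norm_sq (hp.le_one hpos) x) hc.le).trans (h x)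
    have h2 := mul_le_mul_of_nonneg_left h1 (by positivity : 0 ≤ κ * m)
    have h3 : κ * m * spread A p x ≤ 1 / 2 * spread A p x := by
      refine mul_le_mul_of_nonneg_right ?_ (spread_nonneg hAv hnn x)
      calc κ * m ≤ (1 / 2) * 1 := mul_le_mul (min_le_left _ _) hm1 hm0 (by norm_num)
        _ = 1 / 2 := by norm_num
    have h4 : κ * (m * ∑ k, p k * (lam k * ‖x k‖ ^ 2)) ≤
        2 * τ * (m * ∑ k, p k * (lam k * ‖x k‖ ^ 2)) :=
      mul_le_mul_of_nonneg_right (min_le_right _ _) (mul_nonneg hm0 <| Finset.sum_nonneg fun k _ =>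
        mul_nonneg (hnn k) (mul_nonneg (hlam k) (sq_nonneg _)))
    linarith
  have hm3 : 2 * (m ^ 2 * (L ^ 2 * wsq p x)) ≤ κ * c / 2 * m * wsq p x := by
    have h1 := mul_le_mul_of_nonneg_right hm2 (mul_nonneg hm0 hV)
    nlinarith [mul_nonneg hm0 (mul_nonneg hm0 hV)]
  rw [wsq_bigAT hAv]
  have h5 := wsq_sub p x (bigM μ g)
  linarith

end Combination

/-! ### Costs -/

section Costs

variable {M : ℕ}

/-- Symmetry of the second derivative holds at every point where the first derivative is
differentiable; no continuity of the Hessian enters. -/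
lemma inner_hess_symm {J : Param M → ℝ} (h1 : Differentiable ℝ J)
    (h2 : Differentiable ℝ (gradient J)) (w u v : Param M) :
    inner ℝ (hess J w u) v = inner ℝ (hess J w v) u := by
  have hf : ∀ y, HasFDerivAt J (InnerProductSpace.toDual ℝ (Param M) (gradient J y)) y :=
    fun y => (h1 y).hasGradientAt.hasFDerivAt
  have hx : HasFDerivAt (fun y => InnerProductSpace.toDual ℝ (Param M) (gradient J y))
      ((innerSL ℝ : Param M →L[ℝ] Param M →L[ℝ] ℝ).comp (hess J w)) w :=
    (innerSL ℝ : Param M →L[ℝ] Param M →L[ℝ] ℝ).hasFDerivAt.comp w (h2 w).hasFDerivAt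
  exact second_derivative_symmetric hf hx u v

/-- A symmetric operator whose quadratic form lies between `0` and `L` has norm at most `L`. -/
lemma norm_apply_le_of_inner_le {E : Type*} [NormedAddCommGroup E] [InnerProductSpace ℝ E]
    {T : E →L[ℝ] E} {L : ℝ} (hsymm : ∀ u v, inner ℝ (T u) v = inner ℝ (T v) u)
    (h0 : ∀ v, 0 ≤ inner ℝ (T v) v) (hL : ∀ v, inner ℝ (T v) v ≤ L * ‖v‖ ^ 2) (v : E) :
    ‖T v‖ ≤ L * ‖v‖ := by
  rcases eq_or_ne (T v) 0 with hT | hT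
  · rw [hT, norm_zero]
    rcases eq_or_ne v 0 with rfl | hv
    · simp
    · have h := (h0 v).trans (hL v)
      have hv' : 0 < ‖v‖ := norm_pos_iff.2 hv
      by_contra! hneg
      nlinarith
  have hT' : 0 < ‖T v‖ := norm_pos_iff.2 hT
  have hv' : 0 < ‖v‖ := norm_pos_iff.2 fun h => hT (by rw [h, map_zero])
  set a := ‖v‖
  set b := ‖T v‖
  -- Polarisation: with `‖w‖ = ‖v‖`, the forms at `v + w` and `v - w` differ by `4 ⟨Tv, w⟩ = 4 ‖v‖
  -- ‖Tv‖`, and the parallelogram law bounds `‖v + w‖²` by `4 ‖v‖²`.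
  set w : E := (a / b) • T v with hw
  have hnw : ‖w‖ = a := by
    rw [hw, norm_smul, Real.norm_of_nonneg (by positivity)]; field_simp [b]; rfl
  have h1 := hL (v + w)
  have h2 := h0 (v - w)
  have h3 : inner ℝ (T v) w = a * b := by
    rw [hw, real_inner_smul_right, real_inner_self_eq_norm_sq]
    change a / b * b ^ 2 = a * b
    field_simp
  have h4 : inner ℝ (T w) v = a * b := by rw [hsymm, h3]
  have h5 : ‖v + w‖ ^ 2 + ‖v - w‖ ^ 2 = 4 * a ^ 2 := by
    have := parallelogram_law_with_norm ℝ v w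
    rw [hnw] at this
    nlinarith
  have h6 : inner ℝ (T (v + w)) (v + w) - inner ℝ (T (v - w)) (v - w) = 4 * (a * b) := by
    simp only [map_add, map_sub, inner_add_left, inner_add_right, inner_sub_left, inner_sub_right,
      h3, h4]
    ring
  have hL0 : 0 ≤ L := by
    have := (h0 v).trans (hL v)
    by_contra! hneg
    have : 0 < a ^ 2 := by positivity
    nlinarith
  have h7 : a * b ≤ a * (L * a) := by nlinarith [mul_nonneg hL0 (sq_nonneg ‖v - w‖)]
  exact le_of_mul_le_mul_left h7 hv'

/-! ### From bounds on the Hessian to bounds on the gradient. -/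

variable {J : Param M → ℝ} {wo : Param M}

lemma gradient_eq_zero_of_isMin (h : ∀ w, J wo ≤ J w) : gradient J wo = 0 := by
  have : IsLocalMin J wo := Filter.Eventually.of_forall h
  rw [gradient, this.fderiv_eq_zero, map_zero]

lemma norm_gradient_sub_le {L : ℝ} (h2 : Differentiable ℝ (gradient J))
    (hL : ∀ w v, ‖hess J w v‖ ≤ L * ‖v‖) (hL0 : 0 ≤ L) (w w' : Param M) :
    ‖gradient J w - gradient J w'‖ ≤ L * ‖w - w'‖ :=
  convex_univ.norm_image_sub_le_of_norm_fderiv_le (𝕜 := ℝ) (fun x _ => h2 x)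
    (fun x _ => ContinuousLinearMap.opNorm_le_bound _ hL0 (hL x)) trivial trivial

lemma inner_gradient_sub_ge {lam : ℝ} (h2 : Differentiable ℝ (gradient J))
    (h : ∀ w v, lam * ‖v‖ ^ 2 ≤ inner ℝ (hess J w v) v) (w w' : Param M) :
    lam * ‖w - w'‖ ^ 2 ≤ inner ℝ (w - w') (gradient J w - gradient J w') := by
  set v := w - w'
  have hd : ∀ t : ℝ, HasDerivAt (fun t : ℝ => inner ℝ v (gradient J (w' + t • v)))
      (inner ℝ v (hess J (w' + t • v) v)) t := by
    intro t
    have h3 : HasDerivAt (fun t : ℝ => w' + t • v) v t := by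
      simpa using ((hasDerivAt_id t).smul_const v).const_add w'
    have h4 := (h2 (w' + t • v)).hasFDerivAt.comp_hasDerivAt t h3
    exact ((innerSL ℝ v).hasFDerivAt.comp_hasDerivAt t h4)
  -- Monotonicity along the segment replaces integrating the Hessian.
  have hmono : Monotone fun t : ℝ => inner ℝ v (gradient J (w' + t • v)) - t * (lam * ‖v‖ ^ 2) := by
    refine monotone_of_hasDerivAt_nonneg (fun t => (hd t).sub ((hasDerivAt_id t).mul_const _))
      fun t => ?_
    have := h (w' + t • v) v
    rw [real_inner_comm] at this
    simpa using this
  have h5 := hmono zero_le_one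
  simp only [zero_smul, add_zero, one_smul, zero_mul, one_mul, sub_zero] at h5
  rw [show w' + v = w from add_sub_cancel w' w] at h5
  rw [inner_sub_right]
  linarith

end Costs

/-- The bounds on the costs that are used: `λ_k` below and a common `L` above. -/
lemma CostAssumption.exists_bounds {N G M : ℕ} {J : Fin N → Param M → ℝ} {wo : Fin N → Param M}
    {group : Fin N → Fin G} (h : CostAssumption J wo group) :
    ∃ (lam : Fin N → ℝ) (L : ℝ), 0 ≤ L ∧ (∀ k, 0 ≤ lam k) ∧ (∀ m, ∃ k, group k = m ∧ 0 < lam k) ∧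
      (∀ k w v, lam k * ‖v‖ ^ 2 ≤ inner ℝ v (hess (J k) w v)) ∧
      (∀ k w v, ‖hess (J k) w v‖ ≤ L * ‖v‖) ∧
      (∀ k w w', lam k * ‖w - w'‖ ^ 2
        ≤ inner ℝ (w - w') (gradient (J k) w - gradient (J k) w')) ∧
      ∀ k w w', ‖gradient (J k) w - gradient (J k) w'‖ ≤ L * ‖w - w'‖ := by
  obtain ⟨lam, U, h1, h2, h3⟩ := h.hess_bounds
  have hU : ∀ k, 0 ≤ U k := fun k => (h1 k).1.trans (h1 k).2
  have hL0 : 0 ≤ ∑ k, U k := Finset.sum_nonneg fun k _ => hU k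
  have hH : ∀ k w v, ‖hess (J k) w v‖ ≤ (∑ k, U k) * ‖v‖ := fun k w v =>
    (norm_apply_le_of_inner_le
      (inner_hess_symm (h.differentiable k) (h.twice_differentiable k) w)
      (fun v => (mul_nonneg (h1 k).1 (sq_nonneg _)).trans (h2 k w v).1)
      (fun v => (h2 k w v).2) v).trans
      (mul_le_mul_of_nonneg_right (Finset.single_le_sum (fun k _ => hU k) (Finset.mem_univ k))
        (norm_nonneg v))
  refine ⟨lam, ∑ k, U k, hL0, fun k => (h1 k).1, h3,
    fun k w v => by rw [real_inner_comm]; exact (h2 k w v).1, hH,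
    fun k => inner_gradient_sub_ge (h.twice_differentiable k) fun w v => (h2 k w v).1,
    fun k => norm_gradient_sub_le (h.twice_differentiable k) (hH k) hL0⟩

/-! ### Scalar recursions -/

/-- A sequence that eventually satisfies `a (n + 1) ≤ r a n + b` falls below `2 b / (1 - r)`. -/
lemma eventually_le_of_recursion {a : ℕ → ℝ} {r b : ℝ} (hr0 : 0 ≤ r) (hr1 : r < 1) (hb : 0 < b)
    (h : ∀ᶠ n in atTop, a (n + 1) ≤ r * a n + b) : ∀ᶠ n in atTop, a n ≤ 2 * b / (1 - r) := by
  obtain ⟨n₀, hn₀⟩ := eventually_atTop.1 h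
  have h1 : 0 < 1 - r := sub_pos.2 hr1
  -- `B` is the fixed point of `t ↦ r t + b`; the factor two in the bound leaves room for the
  -- decaying transient.
  set B := b / (1 - r) with hB
  have hB0 : 0 < B := by positivity
  have hBr : r * B + b = B := by rw [hB]; field_simp; ring
  have h2 : ∀ j, a (n₀ + j) - B ≤ r ^ j * |a n₀ - B| := by
    intro j
    induction j with
    | zero => simpa using le_abs_self (a n₀ - B)
    | succ j ih =>
      have h3 := hn₀ (n₀ + j) (Nat.le_add_right _ _)
      have h4 := mul_le_mul_of_nonneg_left ih hr0
      rw [pow_succ', mul_assoc, ← Nat.add_assoc]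
      linarith
  have h5 : Tendsto (fun j => r ^ j * |a n₀ - B|) atTop (𝓝 0) := by
    simpa using (tendsto_pow_atTop_nhds_zero_of_lt_one hr0 hr1).mul_const |a n₀ - B|
  obtain ⟨j₀, hj₀⟩ := eventually_atTop.1 (h5.eventually (ge_mem_nhds hB0))
  refine eventually_atTop.2 ⟨n₀ + j₀, fun n hn => ?_⟩
  obtain ⟨j, rfl⟩ := Nat.exists_eq_add_of_le (le_trans (Nat.le_add_right n₀ j₀) hn)
  have := h2 j
  have := hj₀ j (by omega)
  rw [mul_div_assoc, ← hB]
  linarith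

/-! ### Second moments -/

section Probability

variable {Ω : Type*} {mΩ : MeasurableSpace Ω} {P : Measure Ω} {N M : ℕ}

lemma integrable_wsq (p : Fin N → ℝ) {X : Ω → Stack N M} (hX : MemLp X 2 P) :
    Integrable (fun ω => wsq p (X ω)) P := by
  unfold wsq
  refine integrable_finsetSum _ fun k _ => Integrable.const_mul ?_ _
  have h : MemLp (fun ω => X ω k) 2 P :=
    (PiLp.proj (𝕜 := ℝ) 2 (fun _ : Fin N => Param M) k).comp_memLp' hX
  exact h.integrable_norm_pow two_ne_zero

lemma integral_wsq_nonneg {p : Fin N → ℝ} (hp : ∀ k, 0 ≤ p k) (X : Ω → Stack N M) :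
    0 ≤ ∫ ω, wsq p (X ω) ∂P := integral_nonneg fun ω => wsq_nonneg hp (X ω)

lemma memLp_two_of_four [IsProbabilityMeasure P] {E : Type*} [NormedAddCommGroup E] {X : Ω → E}
    (hX : MemLp X 4 P) : MemLp X 2 P :=
  hX.mono_exponent (by norm_num)

lemma integral_wsq_le {p : Fin N → ℝ} {X Y : Ω → Stack N M} {a b : ℝ} (hX : MemLp X 2 P)
    (hY : MemLp Y 2 P) {Z : Ω → Stack N M} (hZ : MemLp Z 2 P)
    (h : ∀ ω, wsq p (Z ω) ≤ a * wsq p (X ω) + b * wsq p (Y ω)) :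
    ∫ ω, wsq p (Z ω) ∂P ≤ a * ∫ ω, wsq p (X ω) ∂P + b * ∫ ω, wsq p (Y ω) ∂P := by
  rw [← integral_const_mul, ← integral_const_mul, ← integral_add
    ((integrable_wsq p hX).const_mul a) ((integrable_wsq p hY).const_mul b)]
  exact integral_mono (integrable_wsq p hZ)
    (((integrable_wsq p hX).const_mul a).add ((integrable_wsq p hY).const_mul b)) h

/-- A square integrable vector known to the past is orthogonal to any martingale difference. -/
lemma integral_inner_eq_zero {m : MeasurableSpace Ω} (hm : m ≤ mΩ) [IsProbabilityMeasure P]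
    {E : Type*} [NormedAddCommGroup E] [InnerProductSpace ℝ E] [CompleteSpace E] {X S : Ω → E}
    (hXm : StronglyMeasurable[m] X) (hX : MemLp X 2 P) (hS : MemLp S 2 P)
    (h0 : P[S | m] =ᵐ[P] 0) : ∫ ω, inner ℝ (X ω) (S ω) ∂P = 0 := by
  have hint : Integrable (fun ω => innerSL ℝ (X ω) (S ω)) P := by
    refine (hX.integrable_norm_pow two_ne_zero |>.add
      (hS.integrable_norm_pow two_ne_zero)).mono'
      (hX.aestronglyMeasurable.inner hS.aestronglyMeasurable) (ae_of_all _ fun ω => ?_)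
    refine (norm_inner_le_norm _ _).trans ?_
    simp only [Pi.add_apply]
    nlinarith [sq_nonneg (‖X ω‖ - ‖S ω‖), sq_nonneg ‖X ω‖, sq_nonneg ‖S ω‖]
  have h1 := condExp_bilin_of_stronglyMeasurable_left (m := m) (innerSL ℝ) hXm hint
    (hS.integrable one_le_two)
  change ∫ ω, innerSL ℝ (X ω) (S ω) ∂P = 0
  rw [← integral_condExp hm, integral_congr_ae h1]
  refine integral_eq_zero_of_ae ?_
  filter_upwards [h0] with ω hω
  simp [hω]

/-- `T S` is again a martingale difference, so the weighted cross term with the past-measurable `X`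
has zero mean. -/
lemma integral_wsq_add {m : MeasurableSpace Ω} (hm : m ≤ mΩ) [IsProbabilityMeasure P]
    (p : Fin N → ℝ) (T : Stack N M →L[ℝ] Stack N M) {X S : Ω → Stack N M}
    (hXm : StronglyMeasurable[m] X) (hX : MemLp X 2 P) (hS : MemLp S 2 P)
    (h0 : P[S | m] =ᵐ[P] 0) :
    ∫ ω, wsq p (X ω + T (S ω)) ∂P = ∫ ω, wsq p (X ω) ∂P + ∫ ω, wsq p (T (S ω)) ∂P := by
  have hTS : MemLp (fun ω => T (S ω)) 2 P := T.comp_memLp' hS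
  have hpX : MemLp (fun ω => bigM p (X ω)) 2 P := (bigM p).comp_memLp' hX
  have hT0 : P[fun ω => T (S ω) | m] =ᵐ[P] 0 := by
    refine (T.comp_condExp_comm (hS.integrable one_le_two) (m := m)).symm.trans ?_
    filter_upwards [h0] with ω hω
    simp [hω]
  have hz : ∫ ω, wbil p (X ω) (T (S ω)) ∂P = 0 :=
    integral_inner_eq_zero hm ((bigM p).continuous.comp_stronglyMeasurable hXm) hpX hTS hT0
  have hi : Integrable (fun ω => wbil p (X ω) (T (S ω))) P := by
    have h1 := integrable_wsq p (hX.add hTS)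
    have h2 := (h1.sub (integrable_wsq p hX)).sub (integrable_wsq p hTS)
    refine (h2.div_const 2).congr (ae_of_all _ fun ω => ?_)
    simp only [Pi.sub_apply, Pi.add_apply, wsq_add]
    ring
  simp only [wsq_add]
  have hXi : Integrable (fun ω => wsq p (X ω) + 2 * wbil p (X ω) (T (S ω))) P :=
    (integrable_wsq p hX).add (hi.const_mul 2)
  rw [integral_add hXi (integrable_wsq p hTS),
    integral_add (integrable_wsq p hX) (hi.const_mul 2), integral_const_mul, hz]
  ring

/-- A conditional fourth moment bound gives a second moment bound. -/
lemma integral_norm_sq_le_of_fourth {m : MeasurableSpace Ω} (hm : m ≤ mΩ)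
    [IsProbabilityMeasure P] {E : Type*} [NormedAddCommGroup E] {U S : Ω → E} {α σ : ℝ}
    (hα : 0 ≤ α) (hUm : StronglyMeasurable[m] U) (hU : MemLp U 4 P) (hS : MemLp S 4 P)
    (h : P[fun ω => ‖S ω‖ ^ 4 | m] ≤ᵐ[P] fun ω => α ^ 2 * ‖U ω‖ ^ 4 + σ ^ 4) :
    ∫ ω, ‖S ω‖ ^ 2 ∂P ≤ α * ∫ ω, ‖U ω‖ ^ 2 ∂P + (σ ^ 2 + 1) := by
  -- `t` is known to the past and `t²` dominates the conditional fourth moment, so the mean of `‖S‖²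
  -- ≤ (t + t⁻¹ ‖S‖⁴) / 2` is at most that of `t`. The added one keeps `t⁻¹` bounded.
  set t : Ω → ℝ := fun ω => α * ‖U ω‖ ^ 2 + (σ ^ 2 + 1) with ht
  have ht1 : ∀ ω, 1 ≤ t ω := fun ω => by
    have : 0 ≤ α * ‖U ω‖ ^ 2 := by positivity
    have : 0 ≤ σ ^ 2 := sq_nonneg σ
    simp only [ht]; linarith
  have hU2 : Integrable (fun ω => ‖U ω‖ ^ 2) P :=
    (memLp_two_of_four hU).integrable_norm_pow two_ne_zero
  have hS2 : Integrable (fun ω => ‖S ω‖ ^ 2) P :=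
    (memLp_two_of_four hS).integrable_norm_pow two_ne_zero
  have hS4 : Integrable (fun ω => ‖S ω‖ ^ 4) P := hS.integrable_norm_pow (by norm_num)
  have hti : Integrable t P := (hU2.const_mul α).add (integrable_const _)
  have htm : StronglyMeasurable[m] fun ω => (t ω)⁻¹ :=
    (((hUm.norm.pow 2).const_mul α).add stronglyMeasurable_const).inv₀
  have hq : Integrable (fun ω => (t ω)⁻¹ * ‖S ω‖ ^ 4) P := by
    refine hS4.mono' ((htm.mono hm).aestronglyMeasurable.mul hS4.aestronglyMeasurable)
      (ae_of_all _ fun ω => ?_)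
    have h1 := ht1 ω
    rw [Real.norm_of_nonneg (by positivity)]
    exact mul_le_of_le_one_left (by positivity) (inv_le_one_of_one_le₀ h1)
  have hqt : ∫ ω, (t ω)⁻¹ * ‖S ω‖ ^ 4 ∂P ≤ ∫ ω, t ω ∂P := by
    rw [← integral_condExp hm]
    refine integral_mono_ae integrable_condExp hti ?_
    filter_upwards [h, condExp_mul_of_stronglyMeasurable_left htm hq hS4] with ω h1 h2
    refine (show _ = _ from h2).trans_le ?_
    have h3 := ht1 ω
    simp only [Pi.mul_apply]
    rw [inv_mul_le_iff₀ (by linarith)]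
    refine h1.trans ?_
    simp only [ht]
    have h4 : 0 ≤ α * ‖U ω‖ ^ 2 := by positivity
    nlinarith [sq_nonneg σ]
  have hpt : ∀ ω, ‖S ω‖ ^ 2 ≤ (1 / 2) * (t ω + (t ω)⁻¹ * ‖S ω‖ ^ 4) := fun ω => by
    have h1 := ht1 ω
    have h2 : 0 ≤ (t ω)⁻¹ * (t ω - ‖S ω‖ ^ 2) ^ 2 := by positivity
    have h3 : (t ω)⁻¹ * (t ω - ‖S ω‖ ^ 2) ^ 2 = t ω - 2 * ‖S ω‖ ^ 2 + (t ω)⁻¹ * ‖S ω‖ ^ 4 := by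
      field_simp
      ring
    linarith
  have h5 := integral_mono hS2 ((hti.add hq).const_mul (1 / 2)) hpt
  simp only [Pi.add_apply] at h5
  rw [integral_const_mul, integral_add hti hq] at h5
  have h6 : ∫ ω, t ω ∂P = α * ∫ ω, ‖U ω‖ ^ 2 ∂P + (σ ^ 2 + 1) := by
    rw [integral_add (hU2.const_mul α) (integrable_const _), integral_const_mul]
    simp
  linarith

end Probability

/-! ### One step of the recursions -/

section Steps

variable {N G M : ℕ} {Gr : SimpleGraph (Fin N)} {group : Fin N → Fin G}
  {A : Matrix (Fin N) (Fin N) ℝ} {p : Fin N → ℝ}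

lemma bigB_apply (A : Matrix (Fin N) (Fin N) ℝ) (J : Fin N → Param M → ℝ) (wo : Fin N → Param M)
    (μ : Fin N → ℝ) (x : Stack N M) :
    bigB A J wo μ x = bigAT A (x - bigM μ (netHess J (col wo) x)) := rfl

/-- The network gradient `col{∇J_k(w_k)}`. -/
noncomputable def netGrad (J : Fin N → Param M → ℝ) (W : Stack N M) : Stack N M :=
  col fun k => gradient (J k) (W k)

lemma continuous_netGrad {J : Fin N → Param M → ℝ} (h : ∀ k, Differentiable ℝ (gradient (J k))) :
    Continuous (netGrad J) :=
  (PiLp.continuous_toLp 2 _).comp (continuous_pi fun k =>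
    (h k).continuous.comp (PiLp.continuous_apply 2 _ k))

lemma norm_netGrad_le {J : Fin N → Param M → ℝ} {wo : Fin N → Param M} {L : ℝ} (hL : 0 ≤ L)
    (h : ∀ k w w', ‖gradient (J k) w - gradient (J k) w'‖ ≤ L * ‖w - w'‖)
    (h0 : ∀ k, gradient (J k) (wo k) = 0) (W : Stack N M) :
    ‖netGrad J W‖ ≤ L * ‖W - col wo‖ := by
  refine le_of_sq_le_sq ?_ (by positivity)
  rw [mul_pow, norm_sq_eq_sum, norm_sq_eq_sum, Finset.mul_sum]
  refine Finset.sum_le_sum fun k _ => ?_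
  rw [← mul_pow]
  gcongr
  have := h k (W k) (wo k)
  rwa [h0, sub_zero] at this

lemma mean_bigAT (hA : IsCombinationMatrix Gr group A) (hp : IsPerronVector group A p)
    (x : Stack N M) :
    bigAT (meanMatrix group p) (bigAT A x) = bigAT (meanMatrix group p) x := by
  rw [bigAT_bigAT, mul_meanMatrix hA hp]

lemma bigAT_mean (hA : IsCombinationMatrix Gr group A) (x : Stack N M) :
    bigAT A (bigAT (meanMatrix group p) x) = bigAT (meanMatrix group p) x := by
  rw [bigAT_bigAT, meanMatrix_mul hA]

lemma mean_mean (hp : IsPerronVector group A p) (x : Stack N M) :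
    bigAT (meanMatrix group p) (bigAT (meanMatrix group p) x) = bigAT (meanMatrix group p) x := by
  rw [bigAT_bigAT, meanMatrix_mul_self hp]

/-- One combination step on the deviation from the group means. -/
lemma wsq_deviation_step (hA : IsCombinationMatrix Gr group A) (hp : IsPerronVector group A p)
    (hpos : ∀ k, 0 < p k) {δ : ℝ} (hδ : 0 < δ) (hδ1 : δ ≤ 1)
    (hmix : ∀ x : Stack N M, bigAT (meanMatrix group p) x = 0 →
      wsq p (bigAT A x) ≤ (1 - δ) * wsq p x) (x y : Stack N M) :
    wsq p (bigAT A (x + y) - bigAT (meanMatrix group p) (bigAT A (x + y))) ≤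
      (1 - δ / 2) * wsq p (x - bigAT (meanMatrix group p) x) + 4 * (1 + 2 / δ) * wsq p y := by
  have hnn := fun k => (hpos k).le
  set Q := bigAT (M := M) (meanMatrix group p) with hQ
  have e : bigAT A (x + y) - Q (bigAT A (x + y)) = bigAT A ((x - Q x) + (y - Q y)) := by
    rw [hQ, mean_bigAT hA hp, ← bigAT_mean hA (x + y), ← map_sub]
    congr 1
    simp only [map_add]
    abel
  have h0 : Q ((x - Q x) + (y - Q y)) = 0 := by
    simp only [map_add, map_sub, hQ, mean_mean hp, sub_self, add_zero]
  -- The weight `δ / 2` is chosen for `(1 - δ)(1 + δ / 2) ≤ 1 - δ / 2`.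
  have h1 := wsq_add_le hnn (half_pos hδ) (x - Q x) (y - Q y)
  have h2 := wsq_sub_le_two hnn y (Q y)
  have h3 : wsq p (Q y) ≤ wsq p y := wsq_bigAT_le (meanMatrix_isAveraging hp hpos) hnn y
  have h4 := wsq_nonneg hnn (x - Q x)
  have h5 := wsq_nonneg hnn y
  have h6 := wsq_nonneg hnn (y - Q y)
  rw [e]
  refine (hmix _ h0).trans ?_
  have h7 := mul_le_mul_of_nonneg_left h1 (sub_nonneg.2 hδ1)
  have h8 : (1 + (δ / 2)⁻¹) * wsq p (y - Q y) ≤ (1 + 2 / δ) * (4 * wsq p y) := by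
    rw [inv_div]
    exact mul_le_mul_of_nonneg_left (by linarith) (by positivity)
  have h9 : (1 - δ) * ((1 + (δ / 2)⁻¹) * wsq p (y - Q y)) ≤
      1 * ((1 + (δ / 2)⁻¹) * wsq p (y - Q y)) :=
    mul_le_mul_of_nonneg_right (by linarith) (by positivity)
  have h10 : (1 - δ) * ((1 + δ / 2) * wsq p (x - Q x)) ≤ (1 - δ / 2) * wsq p (x - Q x) := by
    rw [← mul_assoc]
    exact mul_le_mul_of_nonneg_right (by nlinarith) h4
  linarith

/-- One step of the group means of the difference between two trajectories. -/
lemma wsq_mean_step (hA : IsCombinationMatrix Gr group A) (hp : IsPerronVector group A p)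
    (hpos : ∀ k, 0 < p k) {T : Stack N M →L[ℝ] Stack N M} {c m L : ℝ} (hc : 0 < c) (hm : 0 < m)
    (hcm : c * m ≤ 1) (hT : ∀ x, wsq p (T x) ≤ m ^ 2 * (L ^ 2 * wsq p x))
    (hcon : ∀ x, wsq p (bigAT A (x - T x)) ≤ (1 - c * m) * wsq p x) (x : Stack N M) :
    wsq p (bigAT (meanMatrix group p) (bigAT A (x - T x))) ≤
      (1 - c * m / 2) * wsq p (bigAT (meanMatrix group p) x) +
        3 / c * m * L ^ 2 * wsq p (x - bigAT (meanMatrix group p) x) := by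
  have hnn := fun k => (hpos k).le
  have hAv := meanMatrix_isAveraging hp hpos
  set Q := bigAT (M := M) (meanMatrix group p) with hQ
  -- Since `Q 𝓐ᵀ = Q`, the deviation `x - Qx` reaches the means only through `T`, which is of order
  -- `m`.
  have e : Q (bigAT A (x - T x)) = Q (bigAT A (Q x - T (Q x))) + Q (-T (x - Q x)) := by
    simp only [hQ, mean_bigAT hA hp, map_sub, map_neg, mean_mean hp]
    abel
  have hcm0 : 0 < c * m := mul_pos hc hm
  -- The weight `c m / 2` costs half the rate and turns the `m²` of the forcing into order `m`.
  have h1 := wsq_add_le hnn (half_pos hcm0) (Q (bigAT A (Q x - T (Q x)))) (Q (-T (x - Q x)))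
  have h2 : wsq p (Q (bigAT A (Q x - T (Q x)))) ≤ (1 - c * m) * wsq p (Q x) :=
    (wsq_bigAT_le hAv hnn _).trans (hcon _)
  have h3 : wsq p (Q (-T (x - Q x))) ≤ m ^ 2 * (L ^ 2 * wsq p (x - Q x)) :=
    (wsq_bigAT_le hAv hnn _).trans (by rw [wsq_neg]; exact hT _)
  have h4 := wsq_nonneg hnn (Q x)
  have h5 : 0 ≤ L ^ 2 * wsq p (x - Q x) := mul_nonneg (sq_nonneg _) (wsq_nonneg hnn _)
  have h6 : (1 + c * m / 2) * wsq p (Q (bigAT A (Q x - T (Q x)))) ≤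
      (1 - c * m / 2) * wsq p (Q x) := by
    refine (mul_le_mul_of_nonneg_left h2 (by positivity)).trans ?_
    rw [← mul_assoc]
    exact mul_le_mul_of_nonneg_right (by nlinarith) h4
  have h7 : (1 + (c * m / 2)⁻¹) * m ^ 2 ≤ 3 / c * m := by
    have e1 : (1 + (c * m / 2)⁻¹) * m ^ 2 = (c * m + 2) / c * m := by field_simp
    rw [e1]
    gcongr
    linarith
  have h8 : (1 + (c * m / 2)⁻¹) * wsq p (Q (-T (x - Q x))) ≤
      3 / c * m * (L ^ 2 * wsq p (x - Q x)) := by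
    refine (mul_le_mul_of_nonneg_left h3 (by positivity)).trans ?_
    rw [← mul_assoc]
    exact mul_le_mul_of_nonneg_right h7 h5
  rw [e]
  linarith

/-- On group-constant vectors the `p`-weighted mean of `𝓜𝓗` is `μ_max H̄_m`; the factor `μ_max`
cancels the division in `barH`, so it must not vanish. -/
lemma lift_bigD (hA : IsCombinationMatrix Gr group A) (hp : IsPerronVector group A p)
    {J : Fin N → Param M → ℝ} {wo : Fin N → Param M} {μ : Fin N → ℝ} (hm : stepMax μ ≠ 0)
    (y : Stack G M) :
    lift group (bigD J wo group p μ y) =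
      bigAT (meanMatrix group p) (bigB A J wo μ (lift group y)) := by
  rw [bigB_apply, mean_bigAT hA hp, map_sub, mean_lift hp, ← lift_bigPT]
  ext k : 1
  change y (group k) - stepMax μ • barH J wo group p μ (group k) (y (group k)) =
    y (group k) - ∑ l with group l = group k, p l • (μ l • hess (J l) (wo l) (y (group l)))
  congr 1
  rw [barH, sum_apply, Finset.smul_sum]
  refine Finset.sum_congr rfl fun l hl => ?_
  rw [(Finset.mem_filter.1 hl).2, smul_apply, smul_smul, smul_smul]
  congr 1
  field_simp

/-! ### The random iterates. -/

variable {Ω : Type*} {mΩ : MeasurableSpace Ω} {P : Measure Ω}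

lemma memLp_lift {Y : Ω → Stack G M} (hY : MemLp Y 2 P) :
    MemLp (fun ω => lift group (Y ω)) 2 P := by
  let T : Stack G M →L[ℝ] Stack N M :=
    { toFun := lift group, map_add' := fun _ _ => rfl, map_smul' := fun _ _ => rfl
      cont := (PiLp.continuous_toLp 2 _).comp
        (continuous_pi fun k => PiLp.continuous_apply 2 _ (group k)) }
  exact T.comp_memLp' hY

/-- Allows the iterates to be centred at `𝒲ᵒ`, since a group lies in one cluster and shares its
minimizer. -/
lemma bigAT_col_of_const (hA : IsCombinationMatrix Gr group A) {wo : Fin N → Param M}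
    (h : ∀ k l, group k = group l → wo k = wo l) : bigAT A (col wo) = col wo := by
  ext k : 1
  rw [bigAT_apply]
  have : ∀ l, A l k • col wo l = A l k • wo k := by
    intro l
    by_cases hl : group l = group k
    · rw [← h l k hl]; rfl
    · simp [hA.eq_zero hl]
  rw [Finset.sum_congr rfl fun l _ => this l, ← Finset.sum_smul, hA.col_sum, one_smul]
  rfl

lemma atc_succ (J : Fin N → Param M → ℝ) (ghat : ℕ → Ω → Fin N → Param M → Param M)
    (A : Matrix (Fin N) (Fin N) ℝ) (μ : Fin N → ℝ) (W₀ : Ω → Stack N M) (n : ℕ) (ω : Ω) :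
    atc ghat A μ W₀ (n + 1) ω = bigAT A (atc ghat A μ W₀ n ω
      - bigM μ (netGrad J (atc ghat A μ W₀ n ω) + noise J ghat n ω (atc ghat A μ W₀ n ω))) := by
  ext k : 1
  rw [bigAT_apply]
  change ∑ l, A l k • (atc ghat A μ W₀ n ω l - μ l • ghat n ω l (atc ghat A μ W₀ n ω l)) = _
  refine Finset.sum_congr rfl fun l _ => ?_
  rw [PiLp.sub_apply, bigM_apply, PiLp.add_apply]
  simp only [netGrad, noise, col, add_sub_cancel]

/-- The iterates are adapted and keep finite fourth moments. -/
lemma atc_adapted [IsProbabilityMeasure P] {F : Filtration ℕ mΩ} {J : Fin N → Param M → ℝ}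
    {wo : Fin N → Param M} {ghat : ℕ → Ω → Fin N → Param M → Param M}
    (hNoise : NoiseAssumption P F J wo ghat) (hd : ∀ k, Differentiable ℝ (gradient (J k)))
    {L : ℝ} (hL : ∀ W, ‖netGrad J W‖ ≤ L * ‖W - col wo‖) (A : Matrix (Fin N) (Fin N) ℝ)
    (μ : Fin N → ℝ) {W₀ : Ω → Stack N M} (hm : StronglyMeasurable[F 0] W₀) (h4 : MemLp W₀ 4 P)
    (n : ℕ) :
    StronglyMeasurable[F n] (atc ghat A μ W₀ n) ∧ MemLp (atc ghat A μ W₀ n) 4 P := by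
  obtain ⟨α, σ, -, -, hf⟩ := hNoise.fourth_moment
  induction n with
  | zero => exact ⟨hm, h4⟩
  | succ n ih =>
    obtain ⟨ihm, ih4⟩ := ih
    have hg4 : MemLp (fun ω => netGrad J (atc ghat A μ W₀ n ω)) 4 P :=
      (ih4.sub (memLp_const (col wo))).of_le_mul (c := L)
        ((continuous_netGrad hd).comp_aestronglyMeasurable ih4.aestronglyMeasurable)
        (ae_of_all _ fun ω => hL _)
    have hS4 := (hf n _ ihm ih4).1
    have hSm := hNoise.adapted n _ ihm
    have hWm := ihm.mono (F.mono n.le_succ)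
    have e : atc ghat A μ W₀ (n + 1) = fun ω => bigAT A (atc ghat A μ W₀ n ω
      - bigM μ (netGrad J (atc ghat A μ W₀ n ω) + noise J ghat n ω (atc ghat A μ W₀ n ω))) :=
      funext fun ω => atc_succ J ghat A μ W₀ n ω
    rw [e]
    refine ⟨(bigAT A).continuous.comp_stronglyMeasurable (hWm.sub
      ((bigM μ).continuous.comp_stronglyMeasurable
        (((continuous_netGrad hd).comp_stronglyMeasurable hWm).add hSm))), ?_⟩
    exact (bigAT A).comp_memLp' (ih4.sub ((bigM μ).comp_memLp' (hg4.add hS4)))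

/-- One step of a recursion driven by a martingale difference. -/
lemma integral_wsq_step [IsProbabilityMeasure P] {m : MeasurableSpace Ω} (hm : m ≤ mΩ)
    (T : Stack N M →L[ℝ] Stack N M) {X Z S : Ω → Stack N M} {r b : ℝ}
    (hX : MemLp X 2 P) (hZm : StronglyMeasurable[m] Z) (hZ : MemLp Z 2 P) (hS : MemLp S 2 P)
    (h0 : P[S | m] =ᵐ[P] 0) (hr : ∀ ω, wsq p (Z ω) ≤ r * wsq p (X ω))
    (hb : ∀ s, wsq p (T s) ≤ b * ‖s‖ ^ 2) :
    ∫ ω, wsq p (Z ω + T (S ω)) ∂P ≤ r * ∫ ω, wsq p (X ω) ∂P + b * ∫ ω, ‖S ω‖ ^ 2 ∂P := by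
  rw [integral_wsq_add hm p T hZm hZ hS h0, ← integral_const_mul, ← integral_const_mul]
  exact add_le_add (integral_mono (integrable_wsq p hZ) ((integrable_wsq p hX).const_mul r) hr)
    (integral_mono (integrable_wsq p (T.comp_memLp' hS))
      ((hS.integrable_norm_pow two_ne_zero).const_mul b) fun ω => hb _)

end Steps

/-! ### Moment bounds along the recursions -/

section Moments

variable {Ω : Type*} {mΩ : MeasurableSpace Ω} {P : Measure Ω} [IsProbabilityMeasure P]
  {N G M : ℕ} {p : Fin N → ℝ}

/-- A contracting linear recursion driven by martingale differences has bounded second moments,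
whether or not its initial state is known to the past. -/
lemma eventually_linear_le {F : Filtration ℕ mΩ} (hp : ∀ k, 0 ≤ p k)
    (B T : Stack N M →L[ℝ] Stack N M) {S X : ℕ → Ω → Stack N M} {r b K : ℝ} (hr0 : 0 ≤ r)
    (hr1 : r < 1) (hb0 : 0 < b) (hK : 0 < K) (hB : ∀ x, wsq p (B x) ≤ r * wsq p x)
    (hT : ∀ s, wsq p (T s) ≤ b * ‖s‖ ^ 2) (hSm : ∀ n, StronglyMeasurable[F (n + 1)] (S n))
    (hS : ∀ n, MemLp (S n) 2 P) (hS0 : ∀ n, P[S n | F n] =ᵐ[P] 0)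
    (hSK : ∀ᶠ n in atTop, ∫ ω, ‖S n ω‖ ^ 2 ∂P ≤ K) (hX0 : MemLp (X 0) 2 P)
    (hX : ∀ n ω, X (n + 1) ω = B (X n ω) + T (S n ω)) :
    (∀ n, MemLp (X n) 2 P) ∧
      ∀ᶠ n in atTop, ∫ ω, wsq p (X n ω) ∂P ≤ 4 * (b * K) / (1 - r) + 1 := by
  have hXmem : ∀ n, MemLp (X n) 2 P := by
    intro n
    induction n with
    | zero => exact hX0
    | succ n ih =>
      rw [show X (n + 1) = fun ω => B (X n ω) + T (S n ω) from funext (hX n)]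
      exact (B.comp_memLp' ih).add (T.comp_memLp' (hS n))
  refine ⟨hXmem, ?_⟩
  -- `X 0` need not be measurable for the past, so orthogonality is used for the adapted solution
  -- `Z` started at zero; `X - Z` is the transient `Bⁿ X₀`, absorbed by the `+ 1` of the bound.
  let Z : ℕ → Ω → Stack N M := fun n => Nat.rec 0 (fun j z ω => B (z ω) + T (S j ω)) n
  have hZs : ∀ n, Z (n + 1) = fun ω => B (Z n ω) + T (S n ω) := fun n => rfl
  have hZmeas : ∀ n, StronglyMeasurable[F n] (Z n) ∧ MemLp (Z n) 2 P := by
    intro n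
    induction n with
    | zero => exact ⟨stronglyMeasurable_zero, MemLp.zero⟩
    | succ n ih =>
      rw [hZs]
      exact ⟨(B.continuous.comp_stronglyMeasurable (ih.1.mono (F.mono n.le_succ))).add
        (T.continuous.comp_stronglyMeasurable (hSm n)),
        (B.comp_memLp' ih.2).add (T.comp_memLp' (hS n))⟩
  have hZX : ∀ n ω, X n ω = Z n ω + (B ^ n) (X 0 ω) := by
    intro n ω
    induction n with
    | zero => simp [Z]
    | succ n ih =>
      rw [hX, ih, hZs, pow_succ', mul_apply_eq_comp, map_add]
      exact add_right_comm _ _ _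
  have hpow : ∀ n x, wsq p ((B ^ n) x) ≤ r ^ n * wsq p x := by
    intro n x
    induction n with
    | zero => simp
    | succ n ih =>
      rw [pow_succ', mul_apply_eq_comp, pow_succ', mul_assoc]
      exact (hB _).trans (mul_le_mul_of_nonneg_left ih hr0)
  have hZstep : ∀ᶠ n in atTop,
      ∫ ω, wsq p (Z (n + 1) ω) ∂P ≤ r * ∫ ω, wsq p (Z n ω) ∂P + b * K := by
    filter_upwards [hSK] with n hn
    have hBm : StronglyMeasurable[F n] fun ω => B (Z n ω) :=
      B.continuous.comp_stronglyMeasurable (hZmeas n).1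
    have h := integral_wsq_step (p := p) (F.le n) T (hZmeas n).2 hBm
      (B.comp_memLp' (hZmeas n).2) (hS n) (hS0 n) (fun ω => hB _) hT
    rw [hZs]
    exact h.trans (by gcongr)
  have hZK := eventually_le_of_recursion
    (a := fun n => ∫ ω, wsq p (Z n ω) ∂P) hr0 hr1 (mul_pos hb0 hK) hZstep
  have hlim : Tendsto (fun n => r ^ n * (2 * ∫ ω, wsq p (X 0 ω) ∂P)) atTop (𝓝 0) := by
    simpa using (tendsto_pow_atTop_nhds_zero_of_lt_one hr0 hr1).mul_const
      (2 * ∫ ω, wsq p (X 0 ω) ∂P)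
  filter_upwards [hZK, hlim.eventually (ge_mem_nhds one_pos)] with n h1 h2
  have h3 := integral_wsq_le (p := p) (a := 2) (b := 2 * r ^ n) (hZmeas n).2 hX0 (hXmem n)
    fun ω => by
      rw [hZX n ω]
      have := wsq_add_le_two hp (Z n ω) ((B ^ n) (X 0 ω))
      linarith [hpow n (X 0 ω)]
  have h4 : 4 * (b * K) / (1 - r) = 2 * (2 * (b * K) / (1 - r)) := by ring
  rw [h4]
  linarith

variable {Gr : SimpleGraph (Fin N)} {group : Fin N → Fin G} {A : Matrix (Fin N) (Fin N) ℝ}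

lemma wsq_bigAT_bigM_le (hA : IsAveraging A p) (hp0 : ∀ k, 0 ≤ p k) (hp1 : ∀ k, p k ≤ 1)
    {μ : Fin N → ℝ} {m : ℝ} (h0 : ∀ k, 0 ≤ μ k) (hm : ∀ k, μ k ≤ m) (s : Stack N M) :
    wsq p (bigAT A (bigM μ s)) ≤ m ^ 2 * ‖s‖ ^ 2 :=
  (wsq_bigAT_le hA hp0 _).trans ((wsq_bigM_le hp0 h0 hm s).trans
    (mul_le_mul_of_nonneg_left (wsq_le_norm_sq hp1 s) (sq_nonneg m)))

/-- The noise along the iterates has bounded second moments. -/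
lemma eventually_noise_le {F : Filtration ℕ mΩ} {J : Fin N → Param M → ℝ} {wo : Fin N → Param M}
    {ghat : ℕ → Ω → Fin N → Param M → Param M} (hNoise : NoiseAssumption P F J wo ghat)
    (hd : ∀ k, Differentiable ℝ (gradient (J k))) (hA : IsAveraging A p)
    (hAwo : bigAT A (col wo) = col wo) {q : ℝ} (hq : 0 < q) (hqp : ∀ k, q ≤ p k)
    (hp1 : ∀ k, p k ≤ 1) {L : ℝ} (hL : ∀ W, ‖netGrad J W‖ ≤ L * ‖W - col wo‖) {α σ : ℝ}
    (hα : 0 ≤ α)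
    (hf : ∀ (n : ℕ) (W : Ω → Stack N M), StronglyMeasurable[F n] W → MemLp W 4 P →
      MemLp (fun ω => noise J ghat n ω (W ω)) 4 P ∧
      P[fun ω => ‖noise J ghat n ω (W ω)‖ ^ 4 | F n]
        ≤ᵐ[P] fun ω => α ^ 2 * ‖col wo - W ω‖ ^ 4 + σ ^ 4)
    {μ : Fin N → ℝ} {c m : ℝ} (hc : 0 < c) (hm : 0 < m) (hcm : c * m ≤ 1) (hμ0 : ∀ k, 0 ≤ μ k)
    (hμm : ∀ k, μ k ≤ m) (hmα : m * (2 * α) ≤ c * q)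
    (hcon : ∀ W : Stack N M, wsq p (bigAT A ((W - col wo) - bigM μ (netGrad J W)))
      ≤ (1 - c * m) * wsq p (W - col wo))
    {W₀ : Ω → Stack N M} (hWm : StronglyMeasurable[F 0] W₀) (hW4 : MemLp W₀ 4 P) :
    ∀ᶠ n in atTop, ∫ ω, ‖noise J ghat n ω (atc ghat A μ W₀ n ω)‖ ^ 2 ∂P ≤
      α / q * (4 * m * (σ ^ 2 + 1) / c) + (σ ^ 2 + 1) := by
  have hnn : ∀ k, 0 ≤ p k := fun k => hq.le.trans (hqp k)
  have had := atc_adapted hNoise hd hL A μ hWm hW4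
  set W := atc ghat A μ W₀ with hW
  set v : ℕ → ℝ := fun n => ∫ ω, wsq p (W n ω - col wo) ∂P with hv
  have hU4 : ∀ n, MemLp (fun ω => W n ω - col wo) 4 P := fun n => (had n).2.sub (memLp_const _)
  have hUm : ∀ n, StronglyMeasurable[F n] (fun ω => W n ω - col wo) := fun n =>
    (had n).1.sub stronglyMeasurable_const
  have hU2 := fun n => memLp_two_of_four (hU4 n)
  have hS4 := fun n => (hf n _ (had n).1 (had n).2).1
  have hS2 := fun n => memLp_two_of_four (hS4 n)
  have hs : ∀ n, ∫ ω, ‖noise J ghat n ω (W n ω)‖ ^ 2 ∂P ≤ α / q * v n + (σ ^ 2 + 1) := by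
    intro n
    have h1 := integral_norm_sq_le_of_fourth (F.le n) hα (hUm n) (hU4 n) (hS4 n)
      (σ := σ) (by
        filter_upwards [(hf n _ (had n).1 (had n).2).2] with ω hω
        rwa [norm_sub_rev] at hω)
    have h2 : q * ∫ ω, ‖W n ω - col wo‖ ^ 2 ∂P ≤ v n := by
      rw [← integral_const_mul]
      exact integral_mono (((hU2 n).integrable_norm_pow two_ne_zero).const_mul q)
        (integrable_wsq p (hU2 n)) fun ω => mul_norm_sq_le_wsq hqp _
    have h3 : α * ∫ ω, ‖W n ω - col wo‖ ^ 2 ∂P ≤ α / q * v n := by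
      rw [div_mul_eq_mul_div, le_div_iff₀ hq]
      nlinarith [mul_le_mul_of_nonneg_left h2 hα]
    linarith
  have hgm : ∀ n, StronglyMeasurable[F n] fun ω => netGrad J (W n ω) := fun n =>
    (continuous_netGrad hd).comp_stronglyMeasurable (had n).1
  have hg2 : ∀ n, MemLp (fun ω => netGrad J (W n ω)) 2 P := fun n =>
    (hU2 n).of_le_mul (c := L) (((hgm n).mono (F.le n)).aestronglyMeasurable)
      (ae_of_all _ fun ω => hL _)
  -- The noise contributes `m² (α / q) v n`; `hmα` makes this at most half of the contraction `c m`.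
  have hstep : ∀ n, v (n + 1) ≤ (1 - c * m / 2) * v n + m ^ 2 * (σ ^ 2 + 1) := by
    intro n
    have hZm : StronglyMeasurable[F n] fun ω =>
        bigAT A ((W n ω - col wo) - bigM μ (netGrad J (W n ω))) :=
      (bigAT A).continuous.comp_stronglyMeasurable
        ((hUm n).sub ((bigM μ).continuous.comp_stronglyMeasurable (hgm n)))
    have hZ2 : MemLp (fun ω => bigAT A ((W n ω - col wo) - bigM μ (netGrad J (W n ω)))) 2 P :=
      (bigAT A).comp_memLp' ((hU2 n).sub ((bigM μ).comp_memLp' (hg2 n)))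
    have h1 := integral_wsq_step (p := p) (F.le n) (-(bigAT A).comp (bigM μ)) (hU2 n) hZm hZ2
      (hS2 n) (hNoise.martingale_diff n _ (had n).1 (had n).2) (fun ω => hcon (W n ω))
      (b := m ^ 2) (fun s => by
        rw [neg_apply, wsq_neg]
        exact wsq_bigAT_bigM_le hA hnn hp1 hμ0 hμm s)
    have e : ∀ ω, W (n + 1) ω - col wo =
        bigAT A ((W n ω - col wo) - bigM μ (netGrad J (W n ω))) +
          (-(bigAT A).comp (bigM μ)) (noise J ghat n ω (W n ω)) := by
      intro ω
      rw [hW, atc_succ J]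
      nth_rw 1 [← hAwo]
      simp only [neg_apply, ContinuousLinearMap.comp_apply, map_sub, map_add]
      abel
    have h2 : v (n + 1) ≤ (1 - c * m) * v n
        + m ^ 2 * ∫ ω, ‖noise J ghat n ω (W n ω)‖ ^ 2 ∂P := by
      simp only [hv, e]
      exact h1
    have hv0 : 0 ≤ v n := integral_wsq_nonneg hnn _
    have h3 : m ^ 2 * (α / q * v n) ≤ c * m / 2 * v n := by
      have : m * (α / q) ≤ c / 2 := by
        rw [← mul_div_assoc, div_le_iff₀ hq]; linarith
      have := mul_le_mul_of_nonneg_left this (mul_nonneg hm.le hv0)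
      linarith
    have h4 := mul_le_mul_of_nonneg_left (hs n) (sq_nonneg m)
    linarith
  have hcm0 : 0 < c * m := mul_pos hc hm
  have hfin := eventually_le_of_recursion (a := v) (r := 1 - c * m / 2)
    (b := m ^ 2 * (σ ^ 2 + 1)) (by linarith) (by linarith) (by positivity)
    (Eventually.of_forall hstep)
  filter_upwards [hfin] with n hn
  refine (hs n).trans (add_le_add_left (mul_le_mul_of_nonneg_left (hn.trans_eq ?_) ?_) _)
  · field_simp
    ring
  · positivity

/-- The conclusion for one choice of step-sizes, with explicit constants. -/
lemma eventually_diff_le {F : Filtration ℕ mΩ} {J : Fin N → Param M → ℝ} {wo : Fin N → Param M}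
    {ghat : ℕ → Ω → Fin N → Param M → Param M} (hA : IsCombinationMatrix Gr group A)
    (hp : IsPerronVector group A p) (hpos : ∀ k, 0 < p k) {q : ℝ} (hq : 0 < q)
    (hqp : ∀ k, q ≤ p k) {δ : ℝ} (hδ : 0 < δ) (hδ1 : δ ≤ 1)
    (hmix : ∀ x : Stack N M, bigAT (meanMatrix group p) x = 0 →
      wsq p (bigAT A x) ≤ (1 - δ) * wsq p x)
    {L : ℝ} (hL : ∀ k w v, ‖hess (J k) w v‖ ≤ L * ‖v‖) {μ : Fin N → ℝ} {c K : ℝ} (hc : 0 < c)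
    (hK : 0 < K) (hm : 0 < stepMax μ) (hcm : c * stepMax μ ≤ 1) (hμ0 : ∀ k, 0 ≤ μ k)
    (hμm : ∀ k, μ k ≤ stepMax μ)
    (hcon : ∀ x : Stack N M, wsq p (bigB A J wo μ x) ≤ (1 - c * stepMax μ) * wsq p x)
    {W : ℕ → Ω → Stack N M}
    (hSm : ∀ n, StronglyMeasurable[F (n + 1)] fun ω => noise J ghat n ω (W n ω))
    (hS : ∀ n, MemLp (fun ω => noise J ghat n ω (W n ω)) 2 P)
    (hS0 : ∀ n, P[fun ω => noise J ghat n ω (W n ω) | F n] =ᵐ[P] 0)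
    (hSK : ∀ᶠ n in atTop, ∫ ω, ‖noise J ghat n ω (W n ω)‖ ^ 2 ∂P ≤ K)
    {X₀ : Ω → Stack N M} {Y₀ : Ω → Stack G M} (hX₀ : MemLp X₀ 2 P) (hY₀ : MemLp Y₀ 2 P) {K₄ K₆ : ℝ}
    (hK₄ : 4 * (stepMax μ * K) / c + 1 ≤ K₄)
    (hK₆ : K₆ = 4 * (8 * (1 + 2 / δ) * (L ^ 2 * K₄ + K)) / δ) :
    (∀ n, MemLp (fun ω => longModel J wo ghat A μ W X₀ n ω
      - lift group (lowModel J wo ghat group p μ W Y₀ n ω)) 2 P) ∧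
    ∀ᶠ n in atTop, ∫ ω, ‖longModel J wo ghat A μ W X₀ n ω
      - lift group (lowModel J wo ghat group p μ W Y₀ n ω)‖ ^ 2 ∂P ≤
      2 / q * (12 / c ^ 2 * (L ^ 2 * K₆ + 1) + K₆) * stepMax μ ^ 2 := by
  have hnn := fun k => (hpos k).le
  have hAv := hA.isAveraging hp
  have hp1 := hp.le_one hpos
  set m := stepMax μ with hmdef
  set X := longModel J wo ghat A μ W X₀ with hXdef
  set Y : ℕ → Ω → Stack N M :=
    fun n ω => lift group (lowModel J wo ghat group p μ W Y₀ n ω) with hYdef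
  set S : ℕ → Ω → Stack N M := fun n ω => noise J ghat n ω (W n ω) with hSdef
  set Q := bigAT (M := M) (meanMatrix group p) with hQ
  set T := (bigM μ).comp (netHess J (col wo)) with hTdef
  have hBT : ∀ x, bigB A J wo μ x = bigAT A (x - T x) := fun x => rfl
  have hTle : ∀ x, wsq p (T x) ≤ m ^ 2 * (L ^ 2 * wsq p x) := fun x =>
    (wsq_bigM_le hnn hμ0 hμm _).trans (mul_le_mul_of_nonneg_left
      (wsq_le_of_norm_le hnn _ _ fun k => hL k (wo k) (x k)) (sq_nonneg m))
  have hcm0 : 0 < c * m := mul_pos hc hm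
  have hXs : ∀ n ω, X (n + 1) ω = bigB A J wo μ (X n ω) + bigAT A (bigM μ (S n ω)) :=
    fun n ω => rfl
  -- The lifted centroid model is the long-term recursion averaged by `Q`, with the same noise.
  have hYs : ∀ n ω, Y (n + 1) ω = Q (bigB A J wo μ (Y n ω)) + Q (bigM μ (S n ω)) := by
    intro n ω
    rw [hQ, ← lift_bigD hA hp hm.ne', ← lift_bigPT]
    rfl
  obtain ⟨hX2, hXK⟩ := eventually_linear_le hnn (bigB A J wo μ) ((bigAT A).comp (bigM μ))
    (S := S) (X := X) (r := 1 - c * m) (b := m ^ 2) (by linarith) (by linarith) (by positivity) hK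
    hcon (fun s => wsq_bigAT_bigM_le hAv hnn hp1 hμ0 hμm s) hSm hS hS0 hSK hX₀ hXs
  have hK₄' : 4 * (m ^ 2 * K) / (1 - (1 - c * m)) + 1 ≤ K₄ := by
    refine le_trans (le_of_eq ?_) hK₄
    rw [sub_sub_cancel]
    field_simp
  have hK₄0 : 0 < K₄ := lt_of_lt_of_le (by positivity) hK₄
  have hY2 : ∀ n, MemLp (Y n) 2 P := by
    intro n
    induction n with
    | zero => exact memLp_lift hY₀
    | succ n ih =>
      rw [show Y (n + 1) = _ from funext (hYs n)]
      exact (Q.comp_memLp' ((bigB A J wo μ).comp_memLp' ih)).add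
        (Q.comp_memLp' ((bigM μ).comp_memLp' (hS n)))
  have hQY : ∀ n ω, Q (Y n ω) = Y n ω := fun n ω => mean_lift hp _
  have hR2 : ∀ n, MemLp (fun ω => X n ω - Y n ω) 2 P := fun n => (hX2 n).sub (hY2 n)
  have hD2 : ∀ n, MemLp (fun ω => X n ω - Q (X n ω)) 2 P := fun n =>
    (hX2 n).sub (Q.comp_memLp' (hX2 n))
  have hE2 : ∀ n, MemLp (fun ω => Q (X n ω - Y n ω)) 2 P := fun n => Q.comp_memLp' (hR2 n)
  refine ⟨hR2, ?_⟩
  set d : ℕ → ℝ := fun n => ∫ ω, wsq p (X n ω - Q (X n ω)) ∂P with hd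
  set e : ℕ → ℝ := fun n => ∫ ω, wsq p (Q (X n ω - Y n ω)) ∂P with he
  -- The rate `δ / 2` is free of `m`, so a forcing of order `m²` yields a bound of order `m²`.
  have hdK : ∀ᶠ n in atTop, d n ≤ K₆ * m ^ 2 := by
    have hstep : ∀ᶠ n in atTop, d (n + 1) ≤ (1 - δ / 2) * d n
        + m ^ 2 * (8 * (1 + 2 / δ) * (L ^ 2 * K₄ + K)) := by
      filter_upwards [hXK, hSK] with n h1 h2
      have hy2 : MemLp (fun ω => -T (X n ω) + bigM μ (S n ω)) 2 P :=
        (T.comp_memLp' (hX2 n)).neg.add ((bigM μ).comp_memLp' (hS n))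
      have h3 := integral_wsq_le (p := p) (a := 1 - δ / 2) (b := 4 * (1 + 2 / δ)) (hD2 n) hy2
        (hD2 (n + 1)) fun ω => by
          have e1 : X (n + 1) ω = bigAT A (X n ω + (-T (X n ω) + bigM μ (S n ω))) := by
            rw [hXs, hBT, ← map_add]
            congr 1
            abel
          rw [e1]
          exact wsq_deviation_step hA hp hpos hδ hδ1 hmix _ _
      have h4 : ∫ ω, wsq p (-T (X n ω) + bigM μ (S n ω)) ∂P ≤
          2 * (m ^ 2 * L ^ 2) * ∫ ω, wsq p (X n ω) ∂P + 2 * m ^ 2 * ∫ ω, wsq p (S n ω) ∂P :=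
        integral_wsq_le (hX2 n) (hS n) hy2 fun ω => by
          have := wsq_add_le_two hnn (-T (X n ω)) (bigM μ (S n ω))
          rw [wsq_neg] at this
          have h5 := hTle (X n ω)
          have h6 := wsq_bigM_le hnn hμ0 hμm (S n ω)
          linarith
      have h5 : ∫ ω, wsq p (S n ω) ∂P ≤ K :=
        (integral_mono (integrable_wsq p (hS n)) ((hS n).integrable_norm_pow two_ne_zero)
          fun ω => wsq_le_norm_sq hp1 _).trans h2
      have h6 : ∫ ω, wsq p (-T (X n ω) + bigM μ (S n ω)) ∂P ≤ 2 * m ^ 2 * (L ^ 2 * K₄ + K) := by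
        refine h4.trans ?_
        have h7 := mul_le_mul_of_nonneg_left (h1.trans hK₄')
          (by positivity : 0 ≤ 2 * (m ^ 2 * L ^ 2))
        have h8 := mul_le_mul_of_nonneg_left h5 (by positivity : 0 ≤ 2 * m ^ 2)
        linarith
      have h9 := mul_le_mul_of_nonneg_left h6 (by positivity : 0 ≤ 4 * (1 + 2 / δ))
      linarith
    have := eventually_le_of_recursion (a := d) (by linarith) (by linarith) (by positivity) hstep
    filter_upwards [this] with n hn
    refine hn.trans_eq ?_
    rw [hK₆, sub_sub_cancel]
    field_simp
    ring
  have hK₆0 : 0 < K₆ := by rw [hK₆]; positivity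
  -- The noise cancels because `Q 𝓐ᵀ 𝓜𝒮 = Q 𝓜𝒮`. The forcing is of order `m · d n`, hence `m³`,
  -- against the gap `c m / 2`; the `+ 1` keeps it strictly positive when `L = 0`.
  have heK : ∀ᶠ n in atTop, e n ≤ 12 / c ^ 2 * (L ^ 2 * K₆ + 1) * m ^ 2 := by
    have hstep : ∀ᶠ n in atTop, e (n + 1) ≤ (1 - c * m / 2) * e n
        + 3 / c * m * ((L ^ 2 * K₆ + 1) * m ^ 2) := by
      filter_upwards [hdK] with n h1
      have h2 := integral_wsq_le (p := p) (a := 1 - c * m / 2) (b := 3 / c * m * L ^ 2)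
        (hE2 n) (hD2 n) (hE2 (n + 1)) fun ω => by
          have e1 : Q (X (n + 1) ω - Y (n + 1) ω) =
              Q (bigAT A ((X n ω - Y n ω) - T (X n ω - Y n ω))) := by
            rw [hXs, hYs, ← hBT]
            simp only [map_sub, map_add, hQ, mean_mean hp, mean_bigAT hA hp]
            abel
          have e2 : X n ω - Q (X n ω) = (X n ω - Y n ω) - Q (X n ω - Y n ω) := by
            rw [map_sub, hQY]
            abel
          rw [e1, e2]
          exact wsq_mean_step hA hp hpos hc hm hcm hTle hcon (X n ω - Y n ω)
      have h3 := mul_le_mul_of_nonneg_left h1 (by positivity : 0 ≤ 3 / c * m * L ^ 2)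
      have h4 : 0 ≤ 3 / c * m * m ^ 2 := by positivity
      linarith
    have := eventually_le_of_recursion (a := e) (by linarith) (by linarith) (by positivity) hstep
    filter_upwards [this] with n hn
    refine hn.trans_eq ?_
    rw [sub_sub_cancel]
    field_simp
    ring
  filter_upwards [hdK, heK] with n h1 h2
  have h3 : q * ∫ ω, ‖X n ω - Y n ω‖ ^ 2 ∂P ≤ ∫ ω, wsq p (X n ω - Y n ω) ∂P := by
    rw [← integral_const_mul]
    exact integral_mono (((hR2 n).integrable_norm_pow two_ne_zero).const_mul q)
      (integrable_wsq p (hR2 n)) fun ω => mul_norm_sq_le_wsq hqp _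
  have h4 := integral_wsq_le (p := p) (a := 2) (b := 2) (hE2 n) (hD2 n) (hR2 n) fun ω => by
    have e2 : X n ω - Y n ω = Q (X n ω - Y n ω) + (X n ω - Q (X n ω)) := by
      rw [map_sub, hQY]
      abel
    nth_rw 1 [e2]
    exact wsq_add_le_two hnn _ _
  have h5 : q * ∫ ω, ‖X n ω - Y n ω‖ ^ 2 ∂P ≤
      2 * (12 / c ^ 2 * (L ^ 2 * K₆ + 1) + K₆) * m ^ 2 := by
    refine h3.trans (h4.trans ?_)
    change 2 * e n + 2 * d n ≤ _
    linarith
  rw [div_mul_eq_mul_div, div_mul_eq_mul_div, le_div_iff₀ hq]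
  linarith

end Moments

end ClusterNet

/-! ### Choice of constants and conclusion. -/

theorem mainTheorem7 {Ω : Type*} {mΩ : MeasurableSpace Ω} (P : Measure Ω) [IsProbabilityMeasure P]
    (F : Filtration ℕ mΩ) {N Q G M : ℕ}
    (Gr : SimpleGraph (Fin N)) (cluster : Fin N → Fin Q) (group : Fin N → Fin G)
    (J : Fin N → ClusterNet.Param M → ℝ) (wo : Fin N → ClusterNet.Param M)
    (ghat : ℕ → Ω → Fin N → ClusterNet.Param M → ClusterNet.Param M)
    (A : Matrix (Fin N) (Fin N) ℝ) (p : Fin N → ℝ)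
    (hTop : ClusterNet.TopologyAssumption Gr wo cluster group)
    (hCost : ClusterNet.CostAssumption J wo group)
    (hNoise : ClusterNet.NoiseAssumption P F J wo ghat)
    (hA : ClusterNet.IsCombinationMatrix Gr group A)
    (hp : ClusterNet.IsPerronVector group A p)
    (τ : ℝ) (hτ : 0 < τ) :
    ∃ μ₀ C : ℝ, 0 < μ₀ ∧ 0 ≤ C ∧
      ∀ μ : Fin N → ℝ, (∀ k, 0 < μ k) → (∀ k, τ * ClusterNet.stepMax μ ≤ μ k) →
        ClusterNet.stepMax μ ≤ μ₀ →
      ∀ (W₀ X₀ : Ω → ClusterNet.Stack N M) (Y₀ : Ω → ClusterNet.Stack G M),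
        StronglyMeasurable[F 0] W₀ → MemLp W₀ 4 P → MemLp X₀ 2 P → MemLp Y₀ 2 P →
        limsup (fun n => ∫⁻ ω,
            ‖ClusterNet.longModel J wo ghat A μ (ClusterNet.atc ghat A μ W₀) X₀ n ω
              - ClusterNet.lift group (ClusterNet.lowModel J wo ghat group p μ
                  (ClusterNet.atc ghat A μ W₀) Y₀ n ω)‖ₑ ^ 2 ∂P) atTop
          ≤ ENNReal.ofReal (C * ClusterNet.stepMax μ ^ 2) := by
  open ClusterNet in
  -- Without agents `p` has no minimum and `stepMax μ` is not positive, but all stacked vectors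
  -- vanish.
  rcases isEmpty_or_nonempty (Fin N) with hN | hN
  · refine ⟨1, 0, one_pos, le_rfl, fun μ _ _ _ W₀ X₀ Y₀ _ _ _ _ => ?_⟩
    have h0 : ∀ x : Stack N M, x = 0 := fun x => by
      ext k : 1
      exact hN.elim k
    simp [h0 (_ - _)]
  have hpos := hp.pos hA hTop.group_connected
  have hp1 := hp.le_one hpos
  have hAv := hA.isAveraging hp
  obtain ⟨k₀, hk₀⟩ := Finite.exists_min p
  have hAwo : bigAT A (col wo) = col wo := bigAT_col_of_const hA fun k l h =>
    (hTop.cluster_iff k l).1 (hTop.group_le_cluster k l h)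
  obtain ⟨lam, L, hL0, hlam, hlam', hHl, hHu, hGl, hGu⟩ := hCost.exists_bounds
  obtain ⟨α, σ, hα, -, hf⟩ := hNoise.fourth_moment
  obtain ⟨δ, hδ, hδ1, hmix⟩ := exists_mixing hA hp hTop.group_connected M
  obtain ⟨c, m₁, hc, hm₁, hcon⟩ :=
    exists_contraction hA hp hTop.group_connected M hlam hlam' L hτ
  have hg0 : ∀ k, gradient (J k) (wo k) = 0 := fun k =>
    gradient_eq_zero_of_isMin (hCost.minimizer k)
  have hq := hpos k₀
  set q := p k₀
  have hd := hCost.twice_differentiable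
  -- Here `m₁` stands in for `stepMax μ`, so that `K`, `K₄` and `K₆` do not depend on the
  -- step-sizes.
  set K := α / q * (4 * m₁ * (σ ^ 2 + 1) / c) + (σ ^ 2 + 1) with hKdef
  have hK : 0 < K := by positivity
  set K₄ := 4 * (m₁ * K) / c + 1 with hK₄
  have hK₄0 : 0 < K₄ := by positivity
  set K₆ := 4 * (8 * (1 + 2 / δ) * (L ^ 2 * K₄ + K)) / δ with hK₆
  have hK₆0 : 0 < K₆ := by positivity
  -- `m₁` secures the contraction and the second bound the absorption of the state-dependent noise;
  -- its `+ 1` covers `α = 0`.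
  refine ⟨min m₁ (c * q / (2 * α + 1)), 2 / q * (12 / c ^ 2 * (L ^ 2 * K₆ + 1) + K₆),
    by positivity, by positivity, fun μ hμ hμτ hμmax W₀ X₀ Y₀ hWm hW4 hX₀ hY₀ => ?_⟩
  have hμle : ∀ k, μ k ≤ stepMax μ := fun k => le_ciSup (Set.finite_range μ).bddAbove k
  have hm : 0 < stepMax μ := (hμ k₀).trans_le (hμle k₀)
  have hmm₁ : stepMax μ ≤ m₁ := hμmax.trans (min_le_left _ _)
  have hmα : stepMax μ * (2 * α) ≤ c * q := by
    have := hμmax.trans (min_le_right _ _)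
    rw [le_div_iff₀ (by positivity)] at this
    linarith
  have hμ0 := fun k => (hμ k).le
  obtain ⟨hcm, hcon⟩ := hcon μ (stepMax μ) hm.le hmm₁ hμ0 hμle hμτ
  have hL : ∀ W, ‖netGrad J W‖ ≤ L * ‖W - col wo‖ := norm_netGrad_le hL0 hGu hg0
  have had := atc_adapted hNoise hd hL A μ hWm hW4
  have hSK := eventually_noise_le hNoise hd hAv hAwo hq hk₀ hp1 hL hα hf hc hm hcm hμ0 hμle hmα
    (fun W => hcon (W - col wo) (netGrad J W)
      (fun k => by
        have h := hGl k (W k) (wo k)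
        rw [hg0, sub_zero] at h
        exact h)
      (fun k => by
        have h := hGu k (W k) (wo k)
        rw [hg0, sub_zero] at h
        exact h)) hWm hW4
  have hSK' : ∀ᶠ n in atTop,
      ∫ ω, ‖noise J ghat n ω (atc ghat A μ W₀ n ω)‖ ^ 2 ∂P ≤ K := by
    filter_upwards [hSK] with n hn
    refine hn.trans ?_
    rw [hKdef]
    gcongr
  obtain ⟨hR2, hfin⟩ := eventually_diff_le hA hp hpos hq hk₀ hδ hδ1 hmix hHu hc hK hm hcm hμ0 hμle
    (fun x => hcon x (netHess J (col wo) x) (fun k => hHl k (wo k) (x k))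
      (fun k => hHu k (wo k) (x k)))
    (fun n => hNoise.adapted n _ (had n).1)
    (fun n => memLp_two_of_four (hf n _ (had n).1 (had n).2).1)
    (fun n => hNoise.martingale_diff n _ (had n).1 (had n).2) hSK' hX₀ hY₀
    (K₄ := K₄) (by rw [hK₄]; gcongr) hK₆
  refine limsup_le_of_le (by isBoundedDefault) ?_
  filter_upwards [hfin] with n hn
  refine le_trans (le_of_eq ?_) (ENNReal.ofReal_le_ofReal hn)
  rw [ofReal_integral_eq_lintegral_ofReal ((hR2 n).integrable_norm_pow two_ne_zero)
    (ae_of_all _ fun ω => sq_nonneg _)]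
  exact lintegral_congr fun ω => by rw [← ofReal_norm, ENNReal.ofReal_pow (norm_nonneg _)]
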